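/- For $r,s\in\mathbb{Z}$ put $\rho_{r,s}=1$ if $r,s\ge 0$, $\rho_{r,s}=-1$ if $r,s<0$, and $\rho_{r,s}=0$ otherwise; put $\delta(r)=1$ if $r\equiv 0 \pmod 3$ and $\delta(r)=0$ otherwise; and let $(x;q)_\infty=\prod_{n=0}^\infty(1-xq^n)$. Let $q$ be a complex number with $|q|<1$, and let $q^{1/3}$ be any cube root of $q$, with $q^{m/3}:=(q^{1/3})^m$ for $m\in\mathbb{Z}$. (In the sums on the left, every term with nonzero coefficient has an exponent that is a non-negative integer, so the choice of the cube root does not matter; terms with coefficient $0$ are read as $0$.) Then the series on the left converge absolutely and $$\sum_{k,l,r,s\in\mathbb{Z}} \rho_{r,s} (-1)^{k+l+r+s} \bigl(\delta(k) - \delta (r) \bigr) \bigl(\delta(l) - \delta(s)\bigr)\, q^{(k^2+l^2+r^2+3rs+s^2 +3r+3s +1)/3} =-(q;q)_\infty \Bigl(\sum_{n\in\mathbb{Z}} (-1)^n q^{n^2} \Bigr)^2 \sum_{n\in\mathbb{Z}} (-1)^n q^{5n^2/2+ 3n/2},$$ $$\sum_{k,l,r,s\in\mathbb{Z}} \rho_{r,s}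 (-1)^{k+l+r+s} \bigl(\delta(k) - \delta (r-1) \bigr) \bigl(\delta(l) - \delta(s-1)\bigr)\, q^{(k^2+l^2+r^2+3rs+s^2 +r+s)/3} =(q;q)_\infty \Bigl(\sum_{n\in\mathbb{Z}} (-1)^n q^{n^2} \Bigr)^2 \sum_{n\in\mathbb{Z}} (-1)^n q^{5n^2/2+ n/2},$$ $$\sum_{k,l,r,s\in\mathbb{Z}} \rho_{r,s} \bigl(\delta(k-1) - \delta (r) \bigr) \bigl(\delta(l-1) - \delta(s)\bigr)\, q^{(k(k+1)/2 + l(l+1)/2+2r^2+6rs +2s^2 +3r+3s)/3} =(q^2;q^2)_\infty \Bigl(\sum_{n\in\mathbb{Z}} q^{n(n+1)/2} \Bigr)^2 \sum_{n\in\mathbb{Z}} (-1)^n q^{5n^2+ n},$$ $$\sum_{k,l,r,s\in\mathbb{Z}} \rho_{r,s} \bigl(\delta(k-1) - \delta (r+1) \bigr) \bigl(\delta(l-1) - \delta(s+1)\bigr)\, q^{(k(k+1)/2 + l(l+1)/2+2r^2+6rs +2s^2 +r+s-2)/3} =(q^2;q^2)_\infty \Bigl(\sum_{n\in\mathbb{Z}}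 q^{n(n+1)/2} \Bigr)^2 \sum_{n\in\mathbb{Z}} (-1)^n q^{5n^2+ 3n}.$$ -/

import Mathlib

/-- The sign `ρ_{r,s}`: `1` if `r, s ≥ 0`, `-1` if `r, s < 0`, and `0` otherwise. -/
def rho (r s : ℤ) : ℤ :=
  if 0 ≤ r ∧ 0 ≤ s then 1 else if r < 0 ∧ s < 0 then -1 else 0

/-- The indicator function `δ` of the multiples of three. -/
def delta (r : ℤ) : ℤ :=
  if r ≡ 0 [ZMOD 3] then 1 else 0

/-- The infinite `q`-shifted factorial `(x; q)_∞ = ∏_{n ≥ 0} (1 - x q ^ n)`. -/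
noncomputable def qPochInf (x q : ℂ) : ℂ :=
  ∏' n : ℕ, (1 - x * q ^ n)

/-- The product defining `(x; q)_∞` converges for `|q| < 1`. -/
theorem multipliable_qPochInf (x : ℂ) {q : ℂ} (hq : ‖q‖ < 1) :
    Multipliable fun n : ℕ => 1 - x * q ^ n := by
  have h : Summable fun n : ℕ => ‖-(x * q ^ n)‖ := by
    simpa [norm_mul, norm_pow] using
      (summable_geometric_of_lt_one (norm_nonneg q) hq).mul_left ‖x‖
  simpa [sub_eq_add_neg] using multipliable_one_add_of_summable h

/-- The theta series in one summation index that occur below converge for `|q| < 1`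
(with or without the signs `(-1) ^ n`): apply this with `c n = (-1) ^ n` or `c n = 1`. -/
theorem summable_theta {q : ℂ} (hq : ‖q‖ < 1) (c : ℤ → ℂ) (hc : ∀ n, ‖c n‖ ≤ 1)
    (f : ℤ → ℤ) (hf : ∀ n, 0 ≤ f n) (hfn : ∀ n, |n| ≤ f n + 1) :
    Summable fun n : ℤ => c n * q ^ f n := by
  obtain ⟨u, hu, hu1⟩ := exists_between (max_lt hq (zero_lt_one' ℝ))
  have hu0 : 0 < u := (le_max_right _ _).trans_lt hu
  have hqu : ‖q‖ ≤ u := (le_max_left _ _).trans hu.le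
  have hg : Summable fun n : ℤ => u ^ n.natAbs :=
    Summable.of_nat_of_neg (by simpa using summable_geometric_of_lt_one hu0.le hu1)
      (by simpa using summable_geometric_of_lt_one hu0.le hu1)
  refine Summable.of_norm_bounded (hg.mul_left u⁻¹) fun n => ?_
  obtain ⟨m, hm⟩ := Int.eq_ofNat_of_zero_le (hf n)
  have h1 : n.natAbs ≤ m + 1 := by
    have h := hfn n
    rw [hm, Int.abs_eq_natAbs] at h
    omega
  have h2 : u ^ (m + 1) ≤ u ^ n.natAbs := pow_le_pow_of_le_one hu0.le hu1.le h1
  calc ‖c n * q ^ f n‖ = ‖c n‖ * ‖q‖ ^ m := by simp [hm]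
    _ ≤ 1 * u ^ m := by
        gcongr
        exact hc n
    _ = u⁻¹ * u ^ (m + 1) := by
        rw [pow_succ]
        field_simp
    _ ≤ u⁻¹ * u ^ n.natAbs := by gcongr

open Filter Topology Finset

/-! Put `q = t ^ 3`. Each summand factors as `ρ_{r,s} Q^{rs} α(k,r) α(l,s)`, up to a factor `t` in
the first identity, with `Q = q` in the first two identities and `Q = q ^ 2` in the last two.
Summing over `k` and `l` leaves a Hecke-type double sum `∑ ρ_{r,s} Q^{rs} A(r) A(s)`, where `A(r) =
∑_k α(k,r)`.

Two facts evaluate it. First, `A` is a constant multiple of the convolution of the theta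
coefficients `(-1)^n Q^{n(n-1)/2}` with an explicit sequence `h` (`tsum_sq_eq_theta_conv` and its
three companions). Both sides are single theta series on each class of `r` modulo 3, and the classes
match by product identities between theta series (`theta_relations`).

Second, the double sum is diagonal on shifted theta coefficients: `heckeTheta q i j` vanishes for `i
≠ j` and equals `-(-1)^i q^{i(i+1)/2} (q;q)_∞^3` for `i = j` (`heckeTheta_of_ne`, `heckeTheta_self`,
`heckeTheta_zero_zero`). This is the coefficient form of Kronecker's expression of `∑ ρ_{r,s} q^{rs}
x^r y^s` as a quotient of theta functions. It follows from a shift recurrence, the symmetry in `i,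
j` and Jacobi's identity for `(q;q)_∞^3`.

Hence the quadruple sum is a constant times `∑ (-1)^i Q^{i(i+1)/2} h(i)^2` (`hasSum_quadruple`),
which is the last theta series on the right. The case `q = 0` is a finite count. -/

/-! ### Gaussian binomials and the finite triple product. -/

/-- The Gaussian binomial coefficient, defined by its Pascal recursion. -/
def gaussBinom (q : ℂ) : ℕ → ℕ → ℂ
  | _, 0 => 1
  | 0, _ + 1 => 0
  | n + 1, k + 1 => gaussBinom q n k + q ^ (k + 1) * gaussBinom q n (k + 1)

theorem gaussBinom_zero_right (q : ℂ) (n : ℕ) : gaussBinom q n 0 = 1 := by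
  cases n <;> rfl

theorem gaussBinom_eq_zero_of_lt (q : ℂ) : ∀ {n k : ℕ}, n < k → gaussBinom q n k = 0
  | 0, _ + 1, _ => rfl
  | n + 1, k + 1, h => by
    rw [gaussBinom, gaussBinom_eq_zero_of_lt q (by omega : n < k),
      gaussBinom_eq_zero_of_lt q (by omega : n < k + 1)]
    simp

/-- The finite product `(q; q)_n`. -/
noncomputable def qPochFin (q : ℂ) (n : ℕ) : ℂ := ∏ i ∈ range n, (1 - q * q ^ i)

theorem qPochFin_succ (q : ℂ) (n : ℕ) :
    qPochFin q (n + 1) = qPochFin q n * (1 - q ^ (n + 1)) := by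
  rw [qPochFin, prod_range_succ, ← qPochFin, pow_succ']

/-- The quotient formula with denominators cleared, so that it holds for every `q`. Bounds and
limits of the Gaussian binomials are read off from it. -/
theorem gaussBinom_mul_qPochFin (q : ℂ) : ∀ n k : ℕ,
    gaussBinom q (n + k) k * (qPochFin q k * qPochFin q n) = qPochFin q (n + k)
  | n, 0 => by simp [gaussBinom_zero_right, qPochFin]
  | 0, k + 1 => by
    have h := gaussBinom_mul_qPochFin q 0 k
    simp only [Nat.zero_add] at h ⊢
    rw [gaussBinom, gaussBinom_eq_zero_of_lt q (Nat.lt_succ_self k), qPochFin_succ]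
    linear_combination (1 - q ^ (k + 1)) * h
  | n + 1, k + 1 => by
    have h1 := gaussBinom_mul_qPochFin q (n + 1) k
    have h2 := gaussBinom_mul_qPochFin q n (k + 1)
    rw [show n + (k + 1) = n + 1 + k by ring] at h2
    rw [show n + 1 + (k + 1) = (n + 1 + k) + 1 by ring, gaussBinom, qPochFin_succ q (n + 1 + k)]
    have e1 := qPochFin_succ q k
    have e2 := qPochFin_succ q n
    rw [e1] at h2 ⊢
    rw [e2] at h1 ⊢
    linear_combination (1 - q ^ (k + 1)) * h1 + q ^ (k + 1) * (1 - q ^ (n + 1)) * h2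

theorem choose_two_succ (k : ℕ) : (k + 1).choose 2 = k.choose 2 + k := by
  rw [Nat.choose_succ_succ' k 1, Nat.choose_one_right, add_comm]

/-- The finite `q`-binomial theorem. -/
theorem prod_one_add_mul_pow (q : ℂ) (n : ℕ) : ∀ y : ℂ,
    ∏ i ∈ range n, (1 + y * q ^ i)
      = ∑ k ∈ range (n + 1), q ^ k.choose 2 * gaussBinom q n k * y ^ k := by
  induction n with
  | zero => intro y; simp [gaussBinom]
  | succ n ih =>
    intro y
    have h : ∏ i ∈ range n, (1 + y * q ^ (i + 1)) = ∏ i ∈ range n, (1 + y * q * q ^ i) :=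
      prod_congr rfl fun i _ => by ring
    -- The factor `i = 0` is split off, and the remaining product is the case `n` at `y * q`; this
    -- is why `y` is quantified inside the induction.
    rw [prod_range_succ', h, ih, sum_range_succ' _ (n + 1)]
    have h3 : ∀ k ∈ range (n + 1), q ^ (k + 1).choose 2 * gaussBinom q (n + 1) (k + 1) * y ^ (k + 1)
        = y * (q ^ k.choose 2 * gaussBinom q n k * (y * q) ^ k)
          + q ^ (k + 1).choose 2 * gaussBinom q n (k + 1) * (y * q) ^ (k + 1) := fun k _ => by
      rw [gaussBinom, choose_two_succ]
      ring
    have h4 : ∑ k ∈ range (n + 1), q ^ (k + 1).choose 2 * gaussBinom q n (k + 1) * (y * q) ^ (k + 1)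
        + 1 = ∑ k ∈ range (n + 1), q ^ k.choose 2 * gaussBinom q n k * (y * q) ^ k := by
      rw [sum_range_succ, gaussBinom_eq_zero_of_lt q (Nat.lt_succ_self n), sum_range_succ' _ n]
      simp [gaussBinom_zero_right]
    rw [sum_congr rfl h3, sum_add_distrib, ← mul_sum]
    simp only [gaussBinom_zero_right]
    simp only [pow_zero, mul_one, Nat.choose_zero_succ]
    linear_combination (-1 : ℂ) * h4

/-- The coefficient `(-1) ^ n q ^ (n (n - 1) / 2)` of the theta function `(q, x, q / x; q)_∞`. -/
noncomputable def thetaCoeff (q : ℂ) (n : ℤ) : ℂ := (-1) ^ n * q ^ (n * (n - 1) / 2)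

theorem even_mul_pred (n : ℤ) : n * (n - 1) / 2 * 2 = n * (n - 1) :=
  Int.ediv_mul_cancel (Int.even_mul_pred_self n).two_dvd

theorem even_mul_succ (n : ℤ) : n * (n + 1) / 2 * 2 = n * (n + 1) :=
  Int.ediv_mul_cancel (Int.even_mul_succ_self n).two_dvd

theorem thetaCoeff_succ {q : ℂ} (hq : q ≠ 0) (n : ℤ) :
    thetaCoeff q (n + 1) = -(q ^ n * thetaCoeff q n) := by
  have h : (n + 1) * (n + 1 - 1) / 2 = n + n * (n - 1) / 2 := by
    have h1 := even_mul_pred n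
    have h2 := even_mul_pred (n + 1)
    nlinarith
  rw [thetaCoeff, thetaCoeff, h, zpow_add₀ hq, zpow_add₀ (by norm_num)]
  ring

/-- Matches a shifted theta coefficient with the `k`-th term of the `q`-binomial theorem at `y = -x
q^{-n}`. -/
theorem thetaCoeff_natCast_sub {q : ℂ} (hq : q ≠ 0) (k n : ℕ) :
    thetaCoeff q (k - n) = thetaCoeff q (-n) * (-1) ^ k * q ^ k.choose 2 * (q ^ n)⁻¹ ^ k := by
  induction k with
  | zero => simp
  | succ k ih =>
    rw [show ((k + 1 : ℕ) : ℤ) - n = (k - n : ℤ) + 1 by push_cast; ring, thetaCoeff_succ hq, ih,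
      choose_two_succ, zpow_sub₀ hq]
    simp only [zpow_natCast, div_eq_mul_inv, pow_add, pow_one]
    ring

/-- The finite form of the Jacobi triple product. -/
theorem finite_triple_product {q x : ℂ} (hq : q ≠ 0) (hx : x ≠ 0) (n : ℕ) :
    (∏ i ∈ range n, (1 - x * q ^ i)) * ∏ i ∈ range n, (1 - q / x * q ^ i)
      = ∑ k ∈ range (2 * n + 1),
        thetaCoeff q (k - n) * gaussBinom q (2 * n) k * x ^ ((k : ℤ) - n) := by
  -- Taking `-q^{i+1}/x` out of each factor leaves `1 - x q^{-(i+1)}`. The two products then join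
  -- into `2n` consecutive factors starting at `x q^{-n}`.
  have key : ∀ m : ℕ, (∏ i ∈ range m, (1 - q / x * q ^ i)) =
      thetaCoeff q (-m) * x ^ (-(m : ℤ)) * ∏ i ∈ range m, (1 - x * (q ^ m)⁻¹ * q ^ i) := by
    intro m
    induction m with
    | zero => simp [thetaCoeff]
    | succ m ih =>
      have h : ∏ i ∈ range m, (1 - x * (q ^ (m + 1))⁻¹ * q ^ (i + 1))
          = ∏ i ∈ range m, (1 - x * (q ^ m)⁻¹ * q ^ i) := prod_congr rfl fun i _ => by
        rw [pow_succ, pow_succ, mul_inv]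
        linear_combination (-x * (q ^ m)⁻¹ * q ^ i) * inv_mul_cancel₀ hq
      have h2 := thetaCoeff_succ hq (-((m + 1 : ℕ) : ℤ))
      rw [show -((m + 1 : ℕ) : ℤ) + 1 = -(m : ℤ) by push_cast; ring] at h2
      rw [prod_range_succ, prod_range_succ', h, ih, h2]
      simp only [zpow_neg, zpow_natCast]
      field_simp
      ring
  have hs : (∏ i ∈ range n, (1 - x * (q ^ n)⁻¹ * q ^ i)) * ∏ i ∈ range n, (1 - x * q ^ i)
      = ∏ i ∈ range (2 * n), (1 + -(x * (q ^ n)⁻¹) * q ^ i) := by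
    rw [two_mul, prod_range_add]
    congr 1
    · exact prod_congr rfl fun i _ => by ring
    · refine prod_congr rfl fun i _ => ?_
      rw [pow_add]
      field_simp
      ring
  rw [key, mul_comm, mul_assoc, hs, prod_one_add_mul_pow, mul_sum]
  refine sum_congr rfl fun k _ => ?_
  rw [thetaCoeff_natCast_sub hq, zpow_sub₀ hx, zpow_neg, neg_pow, mul_pow]
  simp only [zpow_natCast]
  field_simp

/-! ### Infinite products -/

theorem tendsto_prod_qPochInf (x : ℂ) {q : ℂ} (hq : ‖q‖ < 1) :
    Tendsto (fun n => ∏ i ∈ range n, (1 - x * q ^ i)) atTop (𝓝 (qPochInf x q)) :=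
  (multipliable_qPochInf x hq).hasProd.tendsto_prod_nat

theorem qPochInf_self_ne_zero {q : ℂ} (hq : ‖q‖ < 1) : qPochInf q q ≠ 0 := by
  have h : Summable fun n : ℕ => ‖-(q * q ^ n)‖ := by
    simpa [norm_mul, norm_pow] using
      (summable_geometric_of_lt_one (norm_nonneg q) hq).mul_left ‖q‖
  have h2 := tprod_one_add_ne_zero_of_summable (f := fun n : ℕ => -(q * q ^ n)) (fun n h0 => by
    have h1 : q ^ (n + 1) = 1 := by rw [pow_succ']; linear_combination -h0
    have h3 := pow_lt_one₀ (norm_nonneg q) hq n.succ_ne_zero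
    rw [← norm_pow, h1] at h3
    simp at h3) h
  simpa [qPochInf, sub_eq_add_neg] using h2

theorem norm_pow_lt_one {q : ℂ} (hq : ‖q‖ < 1) {m : ℕ} (hm : m ≠ 0) : ‖q ^ m‖ < 1 := by
  rw [norm_pow]
  exact pow_lt_one₀ (norm_nonneg q) hq hm

theorem qPochInf_split_two (x : ℂ) {q : ℂ} (hq : ‖q‖ < 1) :
    qPochInf x q = qPochInf x (q ^ 2) * qPochInf (x * q) (q ^ 2) := by
  have hq2 := norm_pow_lt_one hq two_ne_zero
  refine tendsto_nhds_unique ((tendsto_prod_qPochInf x hq).comp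
    (tendsto_id.const_mul_atTop' two_pos)) (((tendsto_prod_qPochInf x hq2).mul
    (tendsto_prod_qPochInf (x * q) hq2)).congr fun n => ?_)
  simp only [Function.comp, id]
  induction n with
  | zero => simp
  | succ n ih =>
    rw [prod_range_succ, prod_range_succ, show 2 * (n + 1) = 2 * n + 1 + 1 by ring,
      prod_range_succ, prod_range_succ, ← ih]
    ring

theorem qPochInf_split_three (x : ℂ) {q : ℂ} (hq : ‖q‖ < 1) :
    qPochInf x q = qPochInf x (q ^ 3) * qPochInf (x * q) (q ^ 3) * qPochInf (x * q ^ 2) (q ^ 3) := by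
  have hq3 := norm_pow_lt_one hq three_ne_zero
  refine tendsto_nhds_unique ((tendsto_prod_qPochInf x hq).comp
    (tendsto_id.const_mul_atTop' three_pos)) ((((tendsto_prod_qPochInf x hq3).mul
    (tendsto_prod_qPochInf (x * q) hq3)).mul
    (tendsto_prod_qPochInf (x * q ^ 2) hq3)).congr fun n => ?_)
  simp only [Function.comp, id]
  induction n with
  | zero => simp
  | succ n ih =>
    rw [prod_range_succ, prod_range_succ, prod_range_succ,
      show 3 * (n + 1) = 3 * n + 1 + 1 + 1 by ring,
      prod_range_succ, prod_range_succ, prod_range_succ, ← ih]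
    ring

theorem qPochInf_mul_neg (x : ℂ) {q : ℂ} (hq : ‖q‖ < 1) :
    qPochInf x q * qPochInf (-x) q = qPochInf (x ^ 2) (q ^ 2) := by
  rw [qPochInf, qPochInf, qPochInf,
    ← (multipliable_qPochInf x hq).tprod_mul (multipliable_qPochInf (-x) hq)]
  exact tprod_congr fun n => by ring

theorem qPochInf_eq_mul (x : ℂ) {q : ℂ} (hq : ‖q‖ < 1) :
    qPochInf x q = (1 - x) * qPochInf (x * q) q := by
  refine tendsto_nhds_unique ((tendsto_prod_qPochInf x hq).comp (tendsto_add_atTop_nat 1))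
    (((tendsto_prod_qPochInf (x * q) hq).const_mul (1 - x)).congr fun n => ?_)
  simp only [Function.comp]
  rw [prod_range_succ', mul_comm]
  simp only [pow_zero, mul_one]
  congr 1
  exact prod_congr rfl fun i _ => by ring

/-! ### Summability of theta series -/

/-- With `L = -log Q` the term is `exp(-L n²/2 + L n/2 + n log X)`, which is dominated by the
standard Jacobi theta bound. The power `m = 1` is needed for Jacobi's cube identity. -/
theorem summable_abs_pow_mul_theta {Q X : ℝ} (hQ : 0 < Q) (hQ1 : Q < 1) (hX : 0 < X) (m : ℕ) :
    Summable fun n : ℤ => |(n : ℝ)| ^ m * (Q ^ (n * (n - 1) / 2) * X ^ n) := by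
  have hL : 0 < -Real.log Q := by linarith [Real.log_neg hQ hQ1]
  set L := -Real.log Q with hLdef
  have hpi := Real.pi_pos
  refine Summable.of_nonneg_of_le (fun n => by positivity) (fun n => ?_)
    (summable_pow_mul_jacobiTheta₂_term_bound ((L / 2 + |Real.log X|) / (2 * Real.pi))
      (T := L / (2 * Real.pi)) (by positivity) m)
  gcongr ?_ * ?_
  · simp
  · rw [← Real.exp_log (zpow_pos hQ _), ← Real.exp_log (zpow_pos hX n), ← Real.exp_add,
      Real.log_zpow, Real.log_zpow]
    apply Real.exp_le_exp.2
    have h1 : ((n * (n - 1) / 2 : ℤ) : ℝ) = n * (n - 1) / 2 := by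
      have := even_mul_pred n
      have h2 : ((n * (n - 1) / 2 : ℤ) : ℝ) * 2 = n * (n - 1) := by exact_mod_cast this
      linarith
    rw [h1]
    have h3 : -Real.pi * (L / (2 * Real.pi) * (n : ℝ) ^ 2
        - 2 * ((L / 2 + |Real.log X|) / (2 * Real.pi)) * |(n : ℝ)|)
        = -(L / 2) * (n : ℝ) ^ 2 + (L / 2 + |Real.log X|) * |(n : ℝ)| := by
      field_simp
      ring
    push_cast
    rw [h3]
    have h4 : (n : ℝ) * Real.log X ≤ |Real.log X| * |(n : ℝ)| := by
      rw [mul_comm, ← abs_mul]; exact le_abs_self _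
    have h5 : L / 2 * n ≤ L / 2 * |(n : ℝ)| := by gcongr; exact le_abs_self _
    have h6 : Real.log Q = -L := by simp [L]
    rw [h6]
    linarith

/-- Comparison with the theta series at `X = ‖q‖ ^ b`; `c` absorbs a constant in the exponent. -/
theorem summable_norm_zpow {q : ℂ} (hq0 : q ≠ 0) (hq : ‖q‖ < 1) (b c : ℤ) (e : ℤ → ℤ)
    (he : ∀ n, n * (n - 1) / 2 + b * n ≤ e n + c) : Summable fun n : ℤ => ‖q ^ e n‖ := by
  have hQ : 0 < ‖q‖ := norm_pos_iff.2 hq0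
  refine Summable.of_nonneg_of_le (fun n => norm_nonneg _) (fun n => ?_)
    ((summable_abs_pow_mul_theta hQ hq (zpow_pos hQ b) 0).mul_left (‖q‖ ^ (-c)))
  rw [norm_zpow, pow_zero, one_mul, ← zpow_mul, ← zpow_add₀ hQ.ne', ← zpow_add₀ hQ.ne']
  exact zpow_le_zpow_right_of_le_one₀ hQ hq.le (by linarith [he n])

theorem norm_neg_one_zpow (n : ℤ) : ‖(-1 : ℂ) ^ n‖ = 1 := by
  simp

theorem summable_norm_thetaCoeff {q : ℂ} (hq0 : q ≠ 0) (hq : ‖q‖ < 1) :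
    Summable fun n : ℤ => ‖thetaCoeff q n‖ := by
  simpa [thetaCoeff] using summable_norm_zpow hq0 hq 0 0 (fun n => n * (n - 1) / 2) (by simp)

/-! ### Passage to the limit: the triple product and Jacobi's cube identity. -/

theorem one_sub_pow_succ_ne_zero {q : ℂ} (hq : ‖q‖ < 1) (n : ℕ) : 1 - q ^ (n + 1) ≠ 0 := by
  intro h
  have h1 := norm_pow_lt_one hq n.succ_ne_zero
  rw [← sub_eq_zero.1 h] at h1
  simp at h1

theorem qPochFin_ne_zero {q : ℂ} (hq : ‖q‖ < 1) (n : ℕ) : qPochFin q n ≠ 0 :=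
  prod_ne_zero_iff.2 fun i _ => by simpa [pow_succ'] using one_sub_pow_succ_ne_zero hq i

theorem tendsto_qPochFin {q : ℂ} (hq : ‖q‖ < 1) :
    Tendsto (qPochFin q) atTop (𝓝 (qPochInf q q)) :=
  tendsto_prod_qPochInf q hq

/-- Both `(q;q)_n` and its inverse converge, hence are bounded. The uniform bound is the domination
needed for the limit under the sum. -/
theorem exists_norm_gaussBinom_le {q : ℂ} (hq : ‖q‖ < 1) :
    ∃ M : ℝ, ∀ n k, ‖gaussBinom q n k‖ ≤ M := by
  obtain ⟨A, hA⟩ := (Metric.isBounded_range_of_tendsto _ (tendsto_qPochFin hq)).exists_norm_le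
  obtain ⟨B, hB⟩ := (Metric.isBounded_range_of_tendsto _
    ((tendsto_qPochFin hq).inv₀ (qPochInf_self_ne_zero hq))).exists_norm_le
  have hA0 : 0 ≤ A := (norm_nonneg _).trans (hA _ ⟨0, rfl⟩)
  have hB0 : 0 ≤ B := (norm_nonneg _).trans (hB _ ⟨0, rfl⟩)
  refine ⟨A * (B * B), fun n k => ?_⟩
  rcases lt_or_ge n k with h | h
  · rw [gaussBinom_eq_zero_of_lt q h, norm_zero]
    positivity
  · obtain ⟨m, rfl⟩ := Nat.exists_eq_add_of_le' h
    have h1 : gaussBinom q (m + k) k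
        = qPochFin q (m + k) * ((qPochFin q k)⁻¹ * (qPochFin q m)⁻¹) := by
      have := qPochFin_ne_zero hq k
      have := qPochFin_ne_zero hq m
      rw [← gaussBinom_mul_qPochFin]
      field_simp
    rw [h1, norm_mul, norm_mul]
    gcongr
    · exact hA _ ⟨_, rfl⟩
    · exact hB _ ⟨k, rfl⟩
    · exact hB _ ⟨m, rfl⟩

theorem tendsto_gaussBinom_central {q : ℂ} (hq : ‖q‖ < 1) (j : ℤ) :
    Tendsto (fun n : ℕ => gaussBinom q (2 * n) (j + n).toNat) atTop (𝓝 (qPochInf q q)⁻¹) := by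
  have hE := qPochInf_self_ne_zero hq
  have t1 : Tendsto (fun n : ℕ => (j + n).toNat) atTop atTop :=
    tendsto_atTop.2 fun b => by
      filter_upwards [eventually_ge_atTop (b + j.natAbs)] with n hn
      omega
  have t2 : Tendsto (fun n : ℕ => (n - j).toNat) atTop atTop :=
    tendsto_atTop.2 fun b => by
      filter_upwards [eventually_ge_atTop (b + j.natAbs)] with n hn
      omega
  have t3 : Tendsto (fun n : ℕ => 2 * n) atTop atTop := tendsto_id.const_mul_atTop' two_pos
  have h := ((tendsto_qPochFin hq).comp t3).mul
    ((((tendsto_qPochFin hq).comp t1).mul ((tendsto_qPochFin hq).comp t2)).inv₀ (mul_ne_zero hE hE))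
  rw [mul_inv, mul_inv_cancel_left₀ hE] at h
  refine h.congr' ?_
  filter_upwards [eventually_ge_atTop j.natAbs] with n hn
  have e : 2 * n = (n - j).toNat + (j + n).toNat := by omega
  have := qPochFin_ne_zero hq (j + n).toNat
  have := qPochFin_ne_zero hq (n - j).toNat
  simp only [Function.comp]
  rw [e, ← gaussBinom_mul_qPochFin]
  field_simp

theorem tendsto_sum_thetaCoeff_mul_gaussBinom {q : ℂ} (hq : ‖q‖ < 1) (w : ℤ → ℂ)
    (hw : Summable fun j => ‖thetaCoeff q j * w j‖) :
    Tendsto (fun n : ℕ => ∑ k ∈ range (2 * n + 1),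
        thetaCoeff q (k - n) * gaussBinom q (2 * n) k * w (k - n)) atTop
      (𝓝 ((∑' j, thetaCoeff q j * w j) * (qPochInf q q)⁻¹)) := by
  obtain ⟨M, hM⟩ := exists_norm_gaussBinom_le hq
  rw [← tsum_mul_right]
  have h := tendsto_tsum_of_dominated_convergence (𝓕 := atTop)
    (f := fun (n : ℕ) (j : ℤ) => thetaCoeff q j * w j *
      -- The cut-off below is needed because `toNat` sends negative indices to `0`, where the
      -- Gaussian binomial is `1`; above `2 * n` it vanishes by itself.
      (if -(n : ℤ) ≤ j then gaussBinom q (2 * n) (j + n).toNat else 0))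
    (g := fun j => thetaCoeff q j * w j * (qPochInf q q)⁻¹) (hw.mul_right M) (fun j => by
      refine Tendsto.const_mul _ ((tendsto_gaussBinom_central hq j).congr' ?_)
      filter_upwards [eventually_ge_atTop j.natAbs] with n hn
      rw [if_pos (by omega)])
    (Eventually.of_forall fun n j => by
      rw [norm_mul]
      gcongr
      split_ifs
      · exact hM _ _
      · exact norm_zero.trans_le ((norm_nonneg _).trans (hM 0 0)))
  refine h.congr fun n => ?_
  have hinj : Function.Injective fun k : ℕ => (k : ℤ) - n := fun a b hab => by
    simp only at hab
    omega
  have hsupp : Function.support (fun j : ℤ => thetaCoeff q j * w j *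
      (if -(n : ℤ) ≤ j then gaussBinom q (2 * n) (j + n).toNat else 0))
      ⊆ Set.range fun k : ℕ => (k : ℤ) - n := fun j hj => by
    by_cases h : -(n : ℤ) ≤ j
    · exact ⟨(j + n).toNat, by simp only; omega⟩
    · simp [h] at hj
  rw [← hinj.tsum_eq hsupp]
  rw [tsum_eq_sum (s := range (2 * n + 1)) fun k hk => by
    rw [if_pos (by omega), show ((k : ℤ) - n + n).toNat = k by omega,
      gaussBinom_eq_zero_of_lt q (by simpa [Nat.succ_le_iff] using hk), mul_zero]]
  refine sum_congr rfl fun k _ => ?_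
  rw [if_pos (by omega), show ((k : ℤ) - n + n).toNat = k by omega]
  ring

theorem summable_norm_thetaCoeff_mul_zpow {q x : ℂ} (hq0 : q ≠ 0) (hq : ‖q‖ < 1) (hx : x ≠ 0) :
    Summable fun n : ℤ => ‖thetaCoeff q n * x ^ n‖ := by
  simpa [thetaCoeff] using
    summable_abs_pow_mul_theta (norm_pos_iff.2 hq0) hq (norm_pos_iff.2 hx) 0

theorem summable_norm_thetaCoeff_mul_self {q : ℂ} (hq0 : q ≠ 0) (hq : ‖q‖ < 1) :
    Summable fun n : ℤ => ‖thetaCoeff q n * n‖ := by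
  simpa [thetaCoeff, mul_comm] using
    summable_abs_pow_mul_theta (norm_pos_iff.2 hq0) hq one_pos 1

/-- The Jacobi triple product identity. -/
theorem tsum_thetaCoeff_mul_zpow {q x : ℂ} (hq0 : q ≠ 0) (hq : ‖q‖ < 1) (hx : x ≠ 0) :
    ∑' n : ℤ, thetaCoeff q n * x ^ n = qPochInf q q * qPochInf x q * qPochInf (q / x) q := by
  have h1 := tendsto_sum_thetaCoeff_mul_gaussBinom hq (fun n => x ^ n)
    (summable_norm_thetaCoeff_mul_zpow hq0 hq hx)
  have h2 := (tendsto_prod_qPochInf x hq).mul (tendsto_prod_qPochInf (q / x) hq)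
  have h3 := tendsto_nhds_unique h1 (h2.congr fun n => finite_triple_product hq0 hx n)
  have hE := qPochInf_self_ne_zero hq
  field_simp at h3
  rw [h3]

/-- At `x = 1` the triple product contains the factor `1 - 1`. -/
theorem tsum_thetaCoeff {q : ℂ} (hq0 : q ≠ 0) (hq : ‖q‖ < 1) :
    ∑' n : ℤ, thetaCoeff q n = 0 := by
  have h := tsum_thetaCoeff_mul_zpow hq0 hq one_ne_zero
  rw [qPochInf_eq_mul 1 hq] at h
  simpa using h

/-- The derivative of the finite triple product at `x = 1`. With `n + 1` factors the product is `(1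
- x) P(x)`, so the derivative is `-P(1)`. -/
theorem sum_thetaCoeff_mul_gaussBinom_mul_self {q : ℂ} (hq : q ≠ 0) (n : ℕ) :
    ∑ k ∈ range (2 * (n + 1) + 1), thetaCoeff q (k - (n + 1 : ℕ))
        * gaussBinom q (2 * (n + 1)) k * (((k : ℤ) - (n + 1 : ℕ) : ℤ) : ℂ)
      = -(qPochFin q n * qPochFin q (n + 1)) := by
  set P : ℂ → ℂ := fun x => (∏ i ∈ range n, (1 - x * q * q ^ i)) *
    ∏ i ∈ range (n + 1), (1 - q / x * q ^ i) with hP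
  have hd : DifferentiableAt ℂ P 1 := by
    refine DifferentiableAt.mul (DifferentiableAt.fun_finsetProd fun i _ => by fun_prop)
      (DifferentiableAt.fun_finsetProd fun i _ => ?_)
    have : DifferentiableAt ℂ (fun x : ℂ => q / x) 1 :=
      (differentiableAt_const q).div differentiableAt_id one_ne_zero
    fun_prop
  have h1 : HasDerivAt (fun x => (1 - x) * P x) (-P 1) 1 := by
    have := ((hasDerivAt_id' (1 : ℂ)).const_sub 1).fun_mul hd.hasDerivAt
    simpa using this
  have h2 : HasDerivAt (fun x : ℂ => ∑ k ∈ range (2 * (n + 1) + 1),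
      thetaCoeff q (k - (n + 1 : ℕ)) * gaussBinom q (2 * (n + 1)) k
        * x ^ ((k : ℤ) - (n + 1 : ℕ)))
      (∑ k ∈ range (2 * (n + 1) + 1), thetaCoeff q (k - (n + 1 : ℕ))
        * gaussBinom q (2 * (n + 1)) k * (((k : ℤ) - (n + 1 : ℕ) : ℤ) : ℂ)) 1 := by
    refine HasDerivAt.fun_sum fun k _ => ?_
    have := (hasDerivAt_zpow ((k : ℤ) - (n + 1 : ℕ)) (1 : ℂ) (Or.inl one_ne_zero)).const_mul
      (thetaCoeff q (k - (n + 1 : ℕ)) * gaussBinom q (2 * (n + 1)) k)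
    simpa using this
  have h3 : (fun x : ℂ => ∑ k ∈ range (2 * (n + 1) + 1),
      thetaCoeff q (k - (n + 1 : ℕ)) * gaussBinom q (2 * (n + 1)) k
        * x ^ ((k : ℤ) - (n + 1 : ℕ))) =ᶠ[𝓝 1] fun x => (1 - x) * P x := by
    filter_upwards [isOpen_ne.mem_nhds (one_ne_zero : (1 : ℂ) ≠ 0)] with x hx
    rw [← finite_triple_product hq hx, prod_range_succ' _ n, hP]
    simp only [pow_zero, mul_one]
    have h : ∏ i ∈ range n, (1 - x * q ^ (i + 1)) = ∏ i ∈ range n, (1 - x * q * q ^ i) :=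
      prod_congr rfl fun i _ => by ring
    rw [h]
    ring
  have h4 := h2.unique (h1.congr_of_eventuallyEq h3)
  rw [h4, hP]
  simp [qPochFin]

/-- Jacobi's identity for the cube of `(q; q)_∞`. -/
theorem tsum_thetaCoeff_mul_self {q : ℂ} (hq0 : q ≠ 0) (hq : ‖q‖ < 1) :
    ∑' n : ℤ, thetaCoeff q n * n = -qPochInf q q ^ 3 := by
  have h1 := (tendsto_sum_thetaCoeff_mul_gaussBinom hq (fun n => (n : ℂ))
    (summable_norm_thetaCoeff_mul_self hq0 hq)).comp (tendsto_add_atTop_nat 1)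
  have h2 := ((tendsto_qPochFin hq).mul ((tendsto_qPochFin hq).comp (tendsto_add_atTop_nat 1))).neg
  have h3 := tendsto_nhds_unique h1
    (h2.congr fun n => (sum_thetaCoeff_mul_gaussBinom_mul_self hq0 n).symm)
  have hE := qPochInf_self_ne_zero hq
  field_simp at h3
  rw [h3]

/-! ### The Hecke-type double sum against theta coefficients. -/

/-- The jump at `r = -1` is independent of `s`, so the boundary term in the recurrence for
`heckeTheta` is a complete theta series. -/
theorem rho_add_one (r s : ℤ) : rho (r + 1) s = rho r s + if r = -1 then 1 else 0 := by
  unfold rho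
  split_ifs <;> omega

theorem rho_comm (r s : ℤ) : rho r s = rho s r := by
  unfold rho
  split_ifs <;> omega

/-- Where `ρ` is nonzero, `r s ≥ 0`. The indefinite factor `q^{rs}` therefore never spoils
summability. -/
theorem norm_rho_mul_zpow_le {q : ℂ} (hq : ‖q‖ < 1) (r s : ℤ) :
    ‖(rho r s : ℂ) * q ^ (r * s)‖ ≤ 1 := by
  have h : 0 ≤ r * s → ‖q ^ (r * s)‖ ≤ 1 := fun h => by
    obtain ⟨m, hm⟩ := Int.eq_ofNat_of_zero_le h
    rw [hm, zpow_natCast, norm_pow]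
    exact pow_le_one₀ (norm_nonneg q) hq.le
  unfold rho
  split_ifs with h1 h2
  · simpa using h (mul_nonneg h1.1 h1.2)
  · simpa using h (mul_nonneg_of_nonpos_of_nonpos h2.1.le h2.2.le)
  · simp

theorem summable_norm_rho_mul {ι κ : Type*} {q : ℂ} (hq : ‖q‖ < 1)
    {f : ι → ℂ} {g : κ → ℂ} (hf : Summable fun a => ‖f a‖) (hg : Summable fun b => ‖g b‖)
    (u : ι → ℤ) (v : κ → ℤ) :
    Summable fun x : ι × κ =>
      ‖(rho (u x.1) (v x.2) : ℂ) * q ^ (u x.1 * v x.2) * (f x.1 * g x.2)‖ := by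
  refine Summable.of_nonneg_of_le (fun _ => norm_nonneg _) (fun x => ?_)
    (hf.mul_of_nonneg hg (fun _ => norm_nonneg _) fun _ => norm_nonneg _)
  rw [norm_mul, norm_mul (f _)]
  exact mul_le_of_le_one_left (by positivity) (norm_rho_mul_zpow_le hq _ _)

theorem summable_norm_thetaCoeff_sub {q : ℂ} (hq0 : q ≠ 0) (hq : ‖q‖ < 1) (i : ℤ) :
    Summable fun n : ℤ => ‖thetaCoeff q (n - i)‖ :=
  (summable_norm_thetaCoeff hq0 hq).comp_injective (Equiv.subRight i).injective

theorem tsum_thetaCoeff_sub {q : ℂ} (hq0 : q ≠ 0) (hq : ‖q‖ < 1) (i : ℤ) :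
    ∑' n : ℤ, thetaCoeff q (n - i) = 0 :=
  ((Equiv.subRight i).tsum_eq (thetaCoeff q)).trans (tsum_thetaCoeff hq0 hq)

/-- The Hecke-type double sum against two shifted theta coefficient sequences, i.e. a coefficient
of the expansion of `θ(x) θ(y) ∑ ρ_{r,s} q ^ (r s) x ^ r y ^ s`. -/
noncomputable def heckeTheta (q : ℂ) (i j : ℤ) : ℂ :=
  ∑' p : ℤ × ℤ, (rho p.1 p.2 : ℂ) * q ^ (p.1 * p.2)
    * (thetaCoeff q (p.1 - i) * thetaCoeff q (p.2 - j))

theorem heckeTheta_comm (q : ℂ) (i j : ℤ) : heckeTheta q i j = heckeTheta q j i := by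
  rw [heckeTheta, ← (Equiv.prodComm ℤ ℤ).tsum_eq]
  refine tsum_congr fun p => ?_
  rw [Equiv.prodComm_apply, Prod.fst_swap, Prod.snd_swap, rho_comm, mul_comm p.2,
    mul_comm (thetaCoeff q _)]

/-- Shift `r` by one: the new factor `q^s` is absorbed by the functional equation of the theta
coefficients in `s`, and the jump of `ρ` contributes a multiple of `∑ thetaCoeff = 0`. -/
theorem heckeTheta_add_one {q : ℂ} (hq0 : q ≠ 0) (hq : ‖q‖ < 1) (i j : ℤ) :
    heckeTheta q (i + 1) (j + 1) = -(q ^ (j + 1) * heckeTheta q i j) := by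
  have hs : Summable fun p : ℤ × ℤ => (rho p.1 p.2 : ℂ) * q ^ (p.1 * p.2)
      * (thetaCoeff q (p.1 - i) * thetaCoeff q (p.2 - j)) :=
    (summable_norm_rho_mul hq (summable_norm_thetaCoeff_sub hq0 hq i)
      (summable_norm_thetaCoeff_sub hq0 hq j) id id).of_norm
  have hf : Summable fun r : ℤ => ‖if r = -1 then thetaCoeff q (r - i) else 0‖ :=
    summable_of_ne_finset_zero (s := {-1}) fun r hr => by
      rw [if_neg (by simpa using hr), norm_zero]
  have hg := summable_norm_thetaCoeff_sub hq0 hq (j + 1)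
  have hfg := (summable_mul_of_summable_norm hf hg)
  have h : ∀ p : ℤ × ℤ, (rho (p.1 + 1) p.2 : ℂ) * q ^ ((p.1 + 1) * p.2)
      * (thetaCoeff q (p.1 + 1 - (i + 1)) * thetaCoeff q (p.2 - (j + 1)))
      = -q ^ (j + 1) * ((rho p.1 p.2 : ℂ) * q ^ (p.1 * p.2)
          * (thetaCoeff q (p.1 - i) * thetaCoeff q (p.2 - j)))
        + (if p.1 = -1 then thetaCoeff q (p.1 - i) else 0) * thetaCoeff q (p.2 - (j + 1)) := by
    rintro ⟨r, s⟩
    have h1 := thetaCoeff_succ hq0 (s - (j + 1))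
    rw [show s - (j + 1) + 1 = s - j by ring, zpow_sub₀ hq0] at h1
    have hj := zpow_ne_zero (j + 1) hq0
    dsimp only
    rw [rho_add_one, h1, show r + 1 - (i + 1) = r - i by ring]
    by_cases hr : r = -1
    · subst hr
      simp only [if_true]
      rw [show (-1 : ℤ) * s = -s by ring, zpow_neg, show (-1 + 1 : ℤ) * s = 0 by ring]
      have hs0 := zpow_ne_zero s hq0
      push_cast
      field_simp
    · rw [if_neg hr, if_neg hr, show (r + 1) * s = r * s + s by ring, zpow_add₀ hq0 (r * s) s]
      push_cast
      field_simp
      ring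
  rw [heckeTheta, ← ((Equiv.addRight (1 : ℤ)).prodCongr (Equiv.refl ℤ)).tsum_eq]
  simp only [Equiv.prodCongr_apply, Prod.map_fst, Prod.map_snd, Equiv.coe_addRight,
    Equiv.coe_refl, id]
  rw [tsum_congr h, Summable.tsum_add (hs.mul_left _) hfg, tsum_mul_left,
    ← tsum_mul_tsum_of_summable_norm hf hg, tsum_thetaCoeff_sub hq0 hq, mul_zero, add_zero,
    neg_mul, heckeTheta]

theorem zpow_ne_zpow {q : ℂ} (hq0 : q ≠ 0) (hq : ‖q‖ < 1) {i j : ℤ} (h : i ≠ j) :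
    q ^ i ≠ q ^ j := fun h1 => by
  have h2 := congrArg norm h1
  rw [norm_zpow, norm_zpow] at h2
  exact h (zpow_right_injective₀ (norm_pos_iff.2 hq0) hq.ne h2)

/-- By symmetry the recurrence holds with multiplier `-q^{i+1}` as well as `-q^{j+1}`; these differ,
so the value is zero. -/
theorem heckeTheta_of_ne {q : ℂ} (hq0 : q ≠ 0) (hq : ‖q‖ < 1) {i j : ℤ} (h : i ≠ j) :
    heckeTheta q i j = 0 := by
  have h1 := heckeTheta_add_one hq0 hq i j
  have h2 := heckeTheta_add_one hq0 hq j i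
  rw [heckeTheta_comm, heckeTheta_comm q j i, h1] at h2
  have h3 : (q ^ (i + 1) - q ^ (j + 1)) * heckeTheta q i j = 0 := by linear_combination h2
  exact (mul_eq_zero.1 h3).resolve_left
    (sub_ne_zero.2 (zpow_ne_zpow hq0 hq (by omega)))

/-- For `n ≥ 0` there are `n + 1` points of weight `1`, for `n ≤ -2` there are `-n - 1` of weight
`-1`, and for `n = -1` none. -/
theorem tsum_rho_antidiagonal (n : ℤ) : HasSum (fun r : ℤ => (rho r (n - r) : ℂ)) (n + 1) := by
  rcases le_or_gt 0 (n + 1) with h | h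
  · have := hasSum_sum_of_ne_finset_zero (L := .unconditional ℤ)
      (f := fun r : ℤ => (rho r (n - r) : ℂ))
      (s := Finset.Icc 0 n) fun r hr => by
        rw [Finset.mem_Icc] at hr
        rw [rho, if_neg (by omega), if_neg (by omega), Int.cast_zero]
    convert this using 1
    rw [Finset.sum_congr rfl (g := fun _ => (1 : ℂ)) fun r hr => by
      rw [Finset.mem_Icc] at hr
      rw [rho, if_pos (by omega), Int.cast_one]]
    rw [Finset.sum_const, Int.card_Icc, nsmul_one, sub_zero, ← Int.cast_natCast,
      Int.toNat_of_nonneg h]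
    push_cast
    rfl
  · have := hasSum_sum_of_ne_finset_zero (L := .unconditional ℤ)
      (f := fun r : ℤ => (rho r (n - r) : ℂ))
      (s := Finset.Icc (n + 1) (-1)) fun r hr => by
        rw [Finset.mem_Icc] at hr
        rw [rho, if_neg (by omega), if_neg (by omega), Int.cast_zero]
    convert this using 1
    rw [Finset.sum_congr rfl (g := fun _ => (-1 : ℂ)) fun r hr => by
      rw [Finset.mem_Icc] at hr
      rw [rho, if_neg (by omega), if_pos (by omega)]
      simp]
    rw [Finset.sum_const, Int.card_Icc, nsmul_eq_mul, ← Int.cast_natCast,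
      Int.toNat_of_nonneg (by omega)]
    push_cast
    ring

/-- On `r + s = n` the three exponents add up to `n(n-1)/2`, so the sum is `∑ thetaCoeff(n) (n +
1)`; Jacobi's cube identity evaluates it. -/
theorem heckeTheta_zero_zero {q : ℂ} (hq0 : q ≠ 0) (hq : ‖q‖ < 1) :
    heckeTheta q 0 0 = -qPochInf q q ^ 3 := by
  have hs := (summable_norm_rho_mul hq (summable_norm_thetaCoeff_sub hq0 hq 0)
    (summable_norm_thetaCoeff_sub hq0 hq 0) id id).of_norm
  let e : ℤ × ℤ ≃ ℤ × ℤ :=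
    ⟨fun p => (p.2, p.1 - p.2), fun p => (p.1 + p.2, p.1), fun p => by simp, fun p => by simp⟩
  have h : ∀ p : ℤ × ℤ, (rho p.2 (p.1 - p.2) : ℂ) * q ^ (p.2 * (p.1 - p.2))
      * (thetaCoeff q (p.2 - 0) * thetaCoeff q (p.1 - p.2 - 0))
      = thetaCoeff q p.1 * (rho p.2 (p.1 - p.2) : ℂ) := by
    rintro ⟨n, r⟩
    have h1 : n * (n - 1) / 2 = r * (n - r) + r * (r - 1) / 2 + (n - r) * (n - r - 1) / 2 := by
      have := even_mul_pred n
      have := even_mul_pred r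
      have := even_mul_pred (n - r)
      nlinarith
    have h2 : (-1 : ℂ) ^ n = (-1) ^ r * (-1) ^ (n - r) := by
      rw [← zpow_add₀ (by norm_num)]
      congr 1
      ring
    simp only [thetaCoeff, sub_zero]
    rw [h1, h2, zpow_add₀ hq0, zpow_add₀ hq0]
    ring
  have h0 : (∑' p : ℤ × ℤ, thetaCoeff q p.1 * (rho p.2 (p.1 - p.2) : ℂ)) = heckeTheta q 0 0 :=
    (tsum_congr fun p => (h p).symm).trans (e.tsum_eq fun p : ℤ × ℤ => (rho p.1 p.2 : ℂ) * q ^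
      (p.1 * p.2)
      * (thetaCoeff q (p.1 - 0) * thetaCoeff q (p.2 - 0)))
  have hs2 : Summable fun p : ℤ × ℤ => thetaCoeff q p.1 * (rho p.2 (p.1 - p.2) : ℂ) :=
    (summable_congr h).1 (e.summable_iff.2 hs)
  rw [← h0, hs2.tsum_prod]
  simp only [tsum_mul_left, (tsum_rho_antidiagonal _).tsum_eq, mul_add, mul_one]
  rw [Summable.tsum_add (summable_norm_thetaCoeff_mul_self hq0 hq).of_norm
    (summable_norm_thetaCoeff hq0 hq).of_norm, tsum_thetaCoeff hq0 hq,
    tsum_thetaCoeff_mul_self hq0 hq, add_zero]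

theorem heckeTheta_self {q : ℂ} (hq0 : q ≠ 0) (hq : ‖q‖ < 1) (i : ℤ) :
    heckeTheta q i i = (-1) ^ i * q ^ (i * (i + 1) / 2) * heckeTheta q 0 0 := by
  have hexp : ∀ n : ℤ, (n + 1) * (n + 1 + 1) / 2 = (n + 1) + n * (n + 1) / 2 := fun n => by
    have := even_mul_succ n
    have := even_mul_succ (n + 1)
    nlinarith
  have hstep : ∀ n : ℤ, (-1 : ℂ) ^ (n + 1) * q ^ ((n + 1) * (n + 1 + 1) / 2)
      = -(q ^ (n + 1) * ((-1) ^ n * q ^ (n * (n + 1) / 2))) := fun n => by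
    rw [hexp, zpow_add₀ hq0 (n + 1), zpow_add₀ (by norm_num : (-1 : ℂ) ≠ 0)]
    ring
  induction i with
  | zero => simp
  | succ n ih => rw [heckeTheta_add_one hq0 hq, ih, hstep]; ring
  | pred n ih =>
    have h1 := heckeTheta_add_one hq0 hq (-(n : ℤ) - 1) (-(n : ℤ) - 1)
    have h2 := hstep (-(n : ℤ) - 1)
    rw [sub_add_cancel] at h1 h2
    have h3 := zpow_ne_zero (-(n : ℤ)) hq0
    rw [ih, h2] at h1
    rw [sub_add_cancel]
    apply mul_left_cancel₀ h3
    linear_combination h1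

/-! ### Reduction of the quadruple sum to a single theta series. -/

theorem summable_norm_quadruple {q : ℂ} (hq : ‖q‖ < 1) {α : ℤ × ℤ → ℂ}
    (hα : Summable fun x => ‖α x‖) :
    Summable fun x : (ℤ × ℤ) × (ℤ × ℤ) =>
      ‖(rho x.1.2 x.2.2 : ℂ) * q ^ (x.1.2 * x.2.2) * (α x.1 * α x.2)‖ :=
  summable_norm_rho_mul hq hα hα Prod.snd Prod.snd

theorem tsum_quadruple {q : ℂ} (hq : ‖q‖ < 1) {α : ℤ × ℤ → ℂ}
    (hα : Summable fun x => ‖α x‖) :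
    ∑' x : (ℤ × ℤ) × (ℤ × ℤ), (rho x.1.2 x.2.2 : ℂ) * q ^ (x.1.2 * x.2.2) * (α x.1 * α x.2)
      = ∑' p : ℤ × ℤ, (rho p.1 p.2 : ℂ) * q ^ (p.1 * p.2)
          * ((∑' k, α (k, p.1)) * ∑' k, α (k, p.2)) := by
  have hs := (summable_norm_quadruple hq hα).of_norm
  let e := (Equiv.prodComm (ℤ × ℤ) (ℤ × ℤ)).trans (Equiv.prodProdProdComm ℤ ℤ ℤ ℤ)
  refine (e.tsum_eq _).symm.trans ((Summable.tsum_prod (e.summable_iff.2 hs)).trans ?_)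
  refine tsum_congr fun p => ?_
  have h1 : ∀ r, Summable fun k => ‖α (k, r)‖ := fun r =>
    hα.comp_injective (Prod.mk_left_injective r)
  rw [tsum_mul_tsum_of_summable_norm (h1 p.1) (h1 p.2), ← tsum_mul_left]
  rfl

/-- Expanding both convolutions and summing over `p` first gives `∑ h(i) h(j) heckeTheta q i j`, of
which only the diagonal survives. -/
theorem tsum_quadruple_thetaCoeff {q : ℂ} (hq0 : q ≠ 0) (hq : ‖q‖ < 1) {h : ℤ → ℂ}
    (hh : Summable fun i => ‖h i‖) :
    ∑' p : ℤ × ℤ, (rho p.1 p.2 : ℂ) * q ^ (p.1 * p.2)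
        * ((∑' i, thetaCoeff q (p.1 - i) * h i) * ∑' i, thetaCoeff q (p.2 - i) * h i)
      = -qPochInf q q ^ 3 * ∑' i : ℤ, (-1) ^ i * q ^ (i * (i + 1) / 2) * h i ^ 2 := by
  have hβ : Summable fun x : ℤ × ℤ => ‖thetaCoeff q (x.2 - x.1) * h x.1‖ := by
    have h1 := hh.mul_of_nonneg (summable_norm_thetaCoeff hq0 hq)
      (fun _ => norm_nonneg _) fun _ => norm_nonneg _
    let e : ℤ × ℤ ≃ ℤ × ℤ :=
      ⟨fun p => (p.1, p.2 - p.1), fun p => (p.1, p.2 + p.1), fun p => by simp, fun p => by simp⟩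
    exact (e.summable_iff.2 h1).congr fun x => by simp [e, mul_comm]
  rw [← tsum_quadruple hq hβ]
  have hs := (summable_norm_quadruple hq hβ).of_norm
  let e := Equiv.prodProdProdComm ℤ ℤ ℤ ℤ
  refine (e.tsum_eq _).symm.trans ((Summable.tsum_prod (e.summable_iff.2 hs)).trans ?_)
  have h2 : ∀ p : ℤ × ℤ, (∑' x : ℤ × ℤ, (rho (e (p, x)).1.2 (e (p, x)).2.2 : ℂ)
      * q ^ ((e (p, x)).1.2 * (e (p, x)).2.2)
      * (thetaCoeff q ((e (p, x)).1.2 - (e (p, x)).1.1) * h (e (p, x)).1.1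
        * (thetaCoeff q ((e (p, x)).2.2 - (e (p, x)).2.1) * h (e (p, x)).2.1)))
      = h p.1 * h p.2 * heckeTheta q p.1 p.2 := fun p => by
    rw [heckeTheta, ← tsum_mul_left]
    refine tsum_congr fun x => ?_
    simp only [e, Equiv.prodProdProdComm_apply]
    ring
  have hinj : Function.Injective fun i : ℤ => (i, i) := fun a b hab => (Prod.mk.inj hab).1
  refine (tsum_congr h2).trans ?_
  rw [← hinj.tsum_eq fun p hp => by
    by_contra hne
    refine hp ?_
    simp only
    rw [heckeTheta_of_ne hq0 hq fun h' => hne ⟨p.1, Prod.ext rfl h'⟩, mul_zero]]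
  rw [← tsum_mul_left]
  refine tsum_congr fun i => ?_
  rw [heckeTheta_self hq0 hq, heckeTheta_zero_zero hq0 hq]
  ring

/-- Evaluation of the quadruple sum when the one-variable sums `∑ k, α (k, r)` are the coefficients
of the product of a theta function and the generating function of `h`. -/
theorem hasSum_quadruple {q : ℂ} (hq0 : q ≠ 0) (hq : ‖q‖ < 1) {α : ℤ × ℤ → ℂ} {h : ℤ → ℂ} (c : ℂ)
    (hα : Summable fun x => ‖α x‖) (hh : Summable fun i => ‖h i‖)
    (hαh : ∀ r, ∑' k, α (k, r) = c * ∑' i, thetaCoeff q (r - i) * h i) :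
    HasSum (fun x : ℤ × ℤ × ℤ × ℤ => (rho x.2.2.1 x.2.2.2 : ℂ) * q ^ (x.2.2.1 * x.2.2.2)
        * (α (x.1, x.2.2.1) * α (x.2.1, x.2.2.2)))
      (-qPochInf q q ^ 3 * c ^ 2 * ∑' i : ℤ, (-1) ^ i * q ^ (i * (i + 1) / 2) * h i ^ 2) := by
  -- Regroups `(k, l, r, s)` as `((k, r), (l, s))`.
  let e := (Equiv.prodAssoc ℤ ℤ (ℤ × ℤ)).symm.trans (Equiv.prodProdProdComm ℤ ℤ ℤ ℤ)
  have hs := (summable_norm_quadruple hq hα).of_norm.hasSum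
  rw [tsum_quadruple hq hα] at hs
  have h1 := e.hasSum_iff.2 hs
  refine (congrArg (HasSum _) ?_).mpr h1
  rw [mul_right_comm, ← tsum_quadruple_thetaCoeff hq0 hq hh, ← tsum_mul_right]
  refine tsum_congr fun p => ?_
  rw [hαh, hαh]
  ring

/-! ### Theta series as quotients of the products `(q^m; q^m)_∞`. -/

theorem thetaCoeff_pow_mul_zpow {q : ℂ} (hq0 : q ≠ 0) (a b : ℕ) (n : ℤ) :
    thetaCoeff (q ^ a) n * (q ^ b) ^ n = (-1) ^ n * q ^ (a * (n * (n - 1) / 2) + b * n) := by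
  rw [thetaCoeff, zpow_add₀ hq0, zpow_mul, zpow_mul, zpow_natCast, zpow_natCast, mul_assoc]

theorem thetaCoeff_pow_mul_neg_zpow {q : ℂ} (hq0 : q ≠ 0) (a b : ℕ) (n : ℤ) :
    thetaCoeff (q ^ a) n * (-q ^ b) ^ n = q ^ (a * (n * (n - 1) / 2) + b * n) := by
  rw [neg_eq_neg_one_mul (q ^ b), mul_zpow, mul_left_comm, thetaCoeff_pow_mul_zpow hq0,
    ← mul_assoc, ← mul_zpow]
  simp

/-- The Jacobi triple product with nome `q ^ (b + c)` at `q ^ b`. -/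
theorem tsum_neg_one_zpow_mul {q : ℂ} (hq0 : q ≠ 0) (hq : ‖q‖ < 1) {b c : ℕ} (h : b + c ≠ 0)
    (e : ℤ → ℤ) (he : ∀ n, e n = ((b + c : ℕ) : ℤ) * (n * (n - 1) / 2) + b * n) :
    ∑' n : ℤ, (-1) ^ n * q ^ e n = qPochInf (q ^ (b + c)) (q ^ (b + c))
      * qPochInf (q ^ b) (q ^ (b + c)) * qPochInf (q ^ c) (q ^ (b + c)) := by
  have hb := pow_ne_zero b hq0
  have h1 := tsum_thetaCoeff_mul_zpow (pow_ne_zero (b + c) hq0) (norm_pow_lt_one hq h) hb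
  rw [show q ^ (b + c) / q ^ b = q ^ c by rw [pow_add]; field_simp] at h1
  rw [← h1]
  exact tsum_congr fun n => by rw [thetaCoeff_pow_mul_zpow hq0, he]

/-- The Jacobi triple product with nome `q ^ (b + c)` at `-q ^ b`. -/
theorem tsum_zpow_eq {q : ℂ} (hq0 : q ≠ 0) (hq : ‖q‖ < 1) {b c : ℕ} (h : b + c ≠ 0)
    (e : ℤ → ℤ) (he : ∀ n, e n = ((b + c : ℕ) : ℤ) * (n * (n - 1) / 2) + b * n) :
    ∑' n : ℤ, q ^ e n = qPochInf (q ^ (b + c)) (q ^ (b + c))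
      * qPochInf (-q ^ b) (q ^ (b + c)) * qPochInf (-q ^ c) (q ^ (b + c)) := by
  have hb := pow_ne_zero b hq0
  have h1 := tsum_thetaCoeff_mul_zpow (pow_ne_zero (b + c) hq0) (norm_pow_lt_one hq h)
    (neg_ne_zero.2 hb)
  rw [show q ^ (b + c) / -q ^ b = -q ^ c by rw [pow_add]; field_simp] at h1
  rw [← h1]
  exact tsum_congr fun n => by rw [thetaCoeff_pow_mul_neg_zpow hq0, he]

theorem tsum_neg_one_zpow_mul_sq {q : ℂ} (hq0 : q ≠ 0) (hq : ‖q‖ < 1) :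
    (∑' n : ℤ, (-1) ^ n * q ^ (n ^ 2)) * qPochInf (q ^ 2) (q ^ 2) = qPochInf q q ^ 2 := by
  rw [tsum_neg_one_zpow_mul hq0 hq (b := 1) (c := 1) (by norm_num) (fun n => n ^ 2) fun n => by
    push_cast; linarith [even_mul_pred n]]
  have h := qPochInf_split_two q hq
  rw [← sq] at h
  rw [h]
  simp only [pow_one, Nat.reduceAdd]
  ring

theorem qPochInf_mul_neg_self {q : ℂ} (hq : ‖q‖ < 1) :
    qPochInf q q * qPochInf (-q) q = qPochInf (q ^ 2) (q ^ 2) :=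
  qPochInf_mul_neg q hq

/-- The factor `2` is `1 - (-1)`, the first factor of `(-1; q)_∞`; equivalently, `n` and `-1 - n`
give the same triangular number. -/
theorem tsum_zpow_triangular {q : ℂ} (hq0 : q ≠ 0) (hq : ‖q‖ < 1) :
    (∑' n : ℤ, q ^ (n * (n + 1) / 2)) * qPochInf q q = 2 * qPochInf (q ^ 2) (q ^ 2) ^ 2 := by
  rw [tsum_zpow_eq hq0 hq (b := 1) (c := 0) (by norm_num) (fun n => n * (n + 1) / 2) fun n => by
    push_cast; linarith [even_mul_pred n, even_mul_succ n]]
  have h := qPochInf_mul_neg_self hq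
  have h1 := qPochInf_eq_mul (-1) hq
  simp only [pow_one, Nat.reduceAdd, pow_zero]
  rw [h1, neg_one_mul, ← h]
  ring

/-- `(q; q^2)_∞` splits into the residues 1, 3, 5 modulo 6; dividing out the residue 3 leaves the
two factors of the triple product. -/
theorem tsum_neg_one_zpow_mul_three {q : ℂ} (hq0 : q ≠ 0) (hq : ‖q‖ < 1) :
    (∑' n : ℤ, (-1) ^ n * q ^ (3 * n ^ 2 + 2 * n)) * qPochInf (q ^ 2) (q ^ 2)
      * qPochInf (q ^ 3) (q ^ 3) = qPochInf q q * qPochInf (q ^ 6) (q ^ 6) ^ 2 := by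
  rw [tsum_neg_one_zpow_mul hq0 hq (b := 5) (c := 1) (by norm_num) (fun n => 3 * n ^ 2 + 2 * n)
    fun n => by push_cast; linarith [even_mul_pred n]]
  have h1 := qPochInf_split_two q hq
  have h2 := qPochInf_split_three q (norm_pow_lt_one hq two_ne_zero)
  have h3 := qPochInf_split_two (q ^ 3) (norm_pow_lt_one hq three_ne_zero)
  rw [← sq] at h1 h3
  rw [h1, h3, h2]
  simp only [← pow_mul, ← pow_succ', pow_one, Nat.reduceAdd, Nat.reduceMul]
  ring

theorem pentagonal_mul_two (n : ℤ) : n * (3 * n + 1) / 2 * 2 = n * (3 * n + 1) :=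
  Int.ediv_mul_cancel ⟨n * (n - 1) / 2 + n ^ 2 + n, by linarith [even_mul_pred n]⟩

theorem tsum_zpow_pentagonal {q : ℂ} (hq0 : q ≠ 0) (hq : ‖q‖ < 1) :
    (∑' n : ℤ, q ^ (n * (3 * n + 1) / 2)) * qPochInf q q * qPochInf (q ^ 6) (q ^ 6)
      = qPochInf (q ^ 3) (q ^ 3) ^ 2 * qPochInf (q ^ 2) (q ^ 2) := by
  have he : ∀ n : ℤ, n * (3 * n + 1) / 2 = ((2 + 1 : ℕ) : ℤ) * (n * (n - 1) / 2) + (2 : ℕ) * n :=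
    fun n => by
      push_cast
      linarith [even_mul_pred n, pentagonal_mul_two n]
  rw [tsum_zpow_eq hq0 hq (b := 2) (c := 1) (by norm_num) (fun n => n * (3 * n + 1) / 2) he]
  have h1 := qPochInf_mul_neg_self hq
  have h2 := qPochInf_split_three (-q) hq
  have h3 := qPochInf_mul_neg_self (norm_pow_lt_one hq three_ne_zero)
  rw [show -q * q = -q ^ 2 by ring, show -q * q ^ 2 = -q ^ 3 by ring] at h2
  rw [← pow_mul] at h3
  simp only [pow_one, Nat.reduceAdd, Nat.reduceMul] at h3 ⊢
  rw [← h1, ← h3, h2]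
  ring

/-! ### Relations between the theta series of the residue classes -/

/-- Every series here is a quotient of `(q^m; q^m)_∞` with `m = 1, 2, 3, 6`, so each relation is a
cancellation. On each left stands a residue-class sum over `k`, on the right the series from the
matching convolution. -/
theorem theta_relations {q : ℂ} (hq0 : q ≠ 0) (hq : ‖q‖ < 1) :
    qPochInf q q * (2 * ∑' n : ℤ, (-1) ^ n * q ^ (3 * n ^ 2 + 2 * n))
        = (∑' n : ℤ, (-1) ^ n * q ^ (n ^ 2)) * ∑' n : ℤ, (q ^ 3) ^ (n * (n + 1) / 2)
    ∧ qPochInf q q * (∑' n : ℤ, (-1) ^ n * (q ^ 3) ^ (n ^ 2))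
        = (∑' n : ℤ, (-1) ^ n * q ^ (n ^ 2)) * ∑' n : ℤ, q ^ (n * (3 * n + 1) / 2)
    ∧ qPochInf (q ^ 2) (q ^ 2) * (2 * ∑' n : ℤ, q ^ (n * (3 * n + 1) / 2))
        = (∑' n : ℤ, q ^ (n * (n + 1) / 2)) * ∑' n : ℤ, (-1) ^ n * (q ^ 3) ^ (n ^ 2)
    ∧ qPochInf (q ^ 2) (q ^ 2) * (∑' n : ℤ, (q ^ 3) ^ (n * (n + 1) / 2))
        = (∑' n : ℤ, q ^ (n * (n + 1) / 2)) * ∑' n : ℤ, (-1) ^ n * q ^ (3 * n ^ 2 + 2 * n) := by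
  have hq3 := norm_pow_lt_one hq three_ne_zero
  have e1 := qPochInf_self_ne_zero hq
  have e2 := qPochInf_self_ne_zero (norm_pow_lt_one hq two_ne_zero)
  have e3 := qPochInf_self_ne_zero hq3
  have e6 := qPochInf_self_ne_zero (norm_pow_lt_one hq (m := 6) (by norm_num))
  have hphi := tsum_neg_one_zpow_mul_sq hq0 hq
  have hpsi := tsum_zpow_triangular hq0 hq
  have hA := tsum_neg_one_zpow_mul_sq (pow_ne_zero 3 hq0) hq3
  have hP := tsum_zpow_triangular (pow_ne_zero 3 hq0) hq3
  have hB := tsum_neg_one_zpow_mul_three hq0 hq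
  have hD := tsum_zpow_pentagonal hq0 hq
  rw [← pow_mul, show 3 * 2 = 6 from rfl] at hA hP
  rw [← eq_div_iff (by assumption)] at hphi hpsi hA hP
  rw [mul_assoc, ← eq_div_iff (mul_ne_zero (by assumption) (by assumption))] at hB hD
  rw [hphi, hpsi, hA, hP, hB, hD]
  refine ⟨?_, ?_, ?_, ?_⟩ <;> field_simp

/-! ### Sums over residue classes modulo three -/

theorem delta_eq_one {n r : ℤ} (h : r = 3 * n) : delta r = 1 := by
  rw [delta, if_pos (Int.modEq_zero_iff_dvd.2 ⟨n, h⟩)]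

theorem delta_eq_zero {n r : ℤ} (h : r = 3 * n + 1 ∨ r = 3 * n - 1) : delta r = 0 := by
  rw [delta, if_neg fun h' => by
    obtain ⟨m, hm⟩ := Int.modEq_zero_iff_dvd.1 h'
    omega]

theorem norm_delta_sub_delta_le (a b : ℤ) : ‖(delta a : ℂ) - (delta b : ℂ)‖ ≤ 1 := by
  unfold delta
  split_ifs <;> simp

theorem tsum_delta_mul (f : ℤ → ℂ) (c : ℤ) :
    ∑' k, (delta (k - c) : ℂ) * f k = ∑' n, f (3 * n + c) := by
  have hinj : Function.Injective fun n : ℤ => 3 * n + c := fun a b h => by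
    simp only at h
    omega
  rw [← hinj.tsum_eq fun k hk => by
    by_contra h
    refine hk ?_
    have : delta (k - c) = 0 := by
      rw [delta, if_neg fun h' => by
        obtain ⟨m, hm⟩ := Int.modEq_zero_iff_dvd.1 h'
        exact h ⟨m, by simp only; omega⟩]
    simp only [this, Int.cast_zero, zero_mul]]
  exact tsum_congr fun n => by rw [delta_eq_one (n := n) (by ring), Int.cast_one, one_mul]

theorem summable_delta_mul {f : ℤ → ℂ} (hf : Summable fun k => ‖f k‖) (c : ℤ) :
    Summable fun k => (delta (k - c) : ℂ) * f k :=
  Summable.of_norm_bounded hf fun k => by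
    rw [norm_mul]
    refine mul_le_of_le_one_left (norm_nonneg _) ?_
    unfold delta
    split_ifs <;> simp

theorem tsum_eq_add_residues {f : ℤ → ℂ} (hf : Summable fun k => ‖f k‖) :
    ∑' k, f k = ∑' n, f (3 * n) + ∑' n, f (3 * n + 1) + ∑' n, f (3 * n - 1) := by
  have h0 := tsum_delta_mul f 0
  have h1 := tsum_delta_mul f 1
  have h2 := tsum_delta_mul f (-1)
  simp only [add_zero, ← sub_eq_add_neg] at h0 h2
  rw [← h0, ← h1, ← h2, ← Summable.tsum_add (summable_delta_mul hf 0) (summable_delta_mul hf 1),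
    ← Summable.tsum_add ((summable_delta_mul hf 0).add (summable_delta_mul hf 1))
      (summable_delta_mul hf (-1))]
  refine tsum_congr fun k => ?_
  have : delta (k - 0) + delta (k - 1) + delta (k - -1) = 1 := by
    obtain ⟨n, h | h | h⟩ : ∃ n, k = 3 * n ∨ k = 3 * n + 1 ∨ k = 3 * n - 1 :=
      ⟨(k + 1) / 3, by omega⟩
    · rw [delta_eq_one (n := n), delta_eq_zero (n := n), delta_eq_zero (n := n)] <;> omega
    · rw [delta_eq_zero (n := n), delta_eq_one (n := n), delta_eq_zero (n := n + 1)] <;> omega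
    · rw [delta_eq_zero (n := n), delta_eq_zero (n := n - 1), delta_eq_one (n := n)] <;> omega
  have h' : (delta (k - 0) : ℂ) + delta (k - 1) + delta (k - -1) = 1 := by exact_mod_cast this
  rw [← add_mul, ← add_mul, h', one_mul]

theorem tsum_delta_sub_mul {f : ℤ → ℂ} (hf : Summable fun k => ‖f k‖) (c : ℤ) (d : ℂ) :
    ∑' k, ((delta (k - c) : ℂ) - d) * f k = ∑' n, f (3 * n + c)
      - d * (∑' n, f (3 * n) + ∑' n, f (3 * n + 1) + ∑' n, f (3 * n - 1)) := by
  rw [← tsum_eq_add_residues hf, ← tsum_delta_mul, ← tsum_mul_left,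
    ← Summable.tsum_sub (summable_delta_mul hf c) (hf.of_norm.mul_left d)]
  exact tsum_congr fun k => by ring

theorem pow_zpow_eq (t : ℂ) (a : ℕ) (m : ℤ) : (t ^ a) ^ m = t ^ (a * m) := by
  rw [zpow_mul, zpow_natCast]

theorem neg_one_zpow_three_mul (n : ℤ) : (-1 : ℂ) ^ (3 * n) = (-1) ^ n := by
  rw [zpow_mul]
  norm_num

/-- `k ↦ -k` exchanges the classes `3n + 1` and `3n - 1`, whence the factor `2`. For `d = δ(r)` only
one of the two series survives. -/
theorem tsum_delta_sub_mul_sq {t : ℂ} (ht0 : t ≠ 0) (ht : ‖t‖ < 1) (d : ℂ) :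
    ∑' k : ℤ, ((delta k : ℂ) - d) * ((-1) ^ k * t ^ (k ^ 2))
      = (1 - d) * (∑' n : ℤ, (-1) ^ n * ((t ^ 3) ^ 3) ^ (n ^ 2))
        + d * (t * (2 * ∑' n : ℤ, (-1) ^ n * (t ^ 3) ^ (3 * n ^ 2 + 2 * n))) := by
  have hf : Summable fun k : ℤ => ‖(-1) ^ k * t ^ (k ^ 2)‖ := by
    simpa using summable_norm_zpow ht0 ht 0 0 (fun k => k ^ 2) fun n => by
      nlinarith [even_mul_pred n, sq_nonneg (n + 1), sq_nonneg n]
  have h := tsum_delta_sub_mul hf 0 d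
  simp only [sub_zero, add_zero] at h
  have h0 : ∀ n : ℤ, (-1) ^ (3 * n) * t ^ ((3 * n) ^ 2)
      = (-1) ^ n * ((t ^ 3) ^ 3) ^ (n ^ 2) := fun n => by
    rw [neg_one_zpow_three_mul, ← pow_mul, pow_zpow_eq]
    congr 2
    push_cast
    ring
  have h1 : ∀ n : ℤ, (-1) ^ (3 * n + 1) * t ^ ((3 * n + 1) ^ 2)
      = -t * ((-1) ^ n * (t ^ 3) ^ (3 * n ^ 2 + 2 * n)) := fun n => by
    rw [zpow_add₀ (by norm_num), neg_one_zpow_three_mul, pow_zpow_eq,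
      show (3 * n + 1) ^ 2 = (3 : ℕ) * (3 * n ^ 2 + 2 * n) + 1 by push_cast; ring,
      zpow_add₀ ht0, zpow_one, zpow_one]
    ring
  have h2 : ∀ n : ℤ, (-1) ^ (3 * -n - 1) * t ^ ((3 * -n - 1) ^ 2)
      = -t * ((-1) ^ n * (t ^ 3) ^ (3 * n ^ 2 + 2 * n)) := fun n => by
    rw [← h1, show 3 * -n - 1 = -(3 * n + 1) by ring, neg_sq, zpow_neg, ← inv_zpow]
    norm_num
  rw [h, ← (Equiv.neg ℤ).tsum_eq fun n : ℤ => (-1) ^ (3 * n - 1) * t ^ ((3 * n - 1) ^ 2)]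
  simp only [Equiv.neg_apply]
  rw [tsum_congr h0, tsum_congr h1, tsum_congr h2, tsum_mul_left]
  ring

/-- Here `k ↦ -1 - k` exchanges the classes `3n` and `3n - 1` and preserves `3n + 1`. -/
theorem tsum_delta_sub_mul_triangular {t : ℂ} (ht0 : t ≠ 0) (ht : ‖t‖ < 1) (d : ℂ) :
    ∑' k : ℤ, ((delta (k - 1) : ℂ) - d) * t ^ (k * (k + 1) / 2)
      = (1 - d) * (t * ∑' n : ℤ, ((t ^ 3) ^ 3) ^ (n * (n + 1) / 2))
        - d * (2 * ∑' n : ℤ, (t ^ 3) ^ (n * (3 * n + 1) / 2)) := by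
  have hf : Summable fun k : ℤ => ‖t ^ (k * (k + 1) / 2)‖ :=
    summable_norm_zpow ht0 ht 1 0 (fun k => k * (k + 1) / 2) fun n => by
      linarith [even_mul_pred n, even_mul_succ n]
  have h := tsum_delta_sub_mul hf 1 d
  have h0 : ∀ n : ℤ, t ^ (3 * n * (3 * n + 1) / 2) = (t ^ 3) ^ (n * (3 * n + 1) / 2) := fun n => by
    rw [← zpow_natCast t, ← zpow_mul]
    congr 1
    push_cast
    linarith [even_mul_succ (3 * n), pentagonal_mul_two n]
  have h1 : ∀ n : ℤ, t ^ ((3 * n + 1) * (3 * n + 1 + 1) / 2)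
      = t * ((t ^ 3) ^ 3) ^ (n * (n + 1) / 2) := fun n => by
    rw [← pow_mul, ← zpow_natCast t, ← zpow_mul, ← zpow_one_add₀ ht0]
    congr 1
    push_cast
    linarith [even_mul_succ n, even_mul_succ (3 * n + 1)]
  have h2 : ∀ n : ℤ, t ^ ((3 * -n - 1) * (3 * -n - 1 + 1) / 2)
      = (t ^ 3) ^ (n * (3 * n + 1) / 2) := fun n => by
    rw [← h0, show (3 * -n - 1) * (3 * -n - 1 + 1) = 3 * n * (3 * n + 1) by ring]
  rw [h, ← (Equiv.neg ℤ).tsum_eq fun n : ℤ => t ^ ((3 * n - 1) * (3 * n - 1 + 1) / 2)]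
  simp only [Equiv.neg_apply]
  rw [tsum_congr h0, tsum_congr h1, tsum_congr h2, tsum_mul_left]
  ring

/-! ### Products of two theta functions -/

theorem neg_one_zpow_eq {x y : ℤ} (k : ℤ) (h : x = y + 2 * k) : (-1 : ℂ) ^ x = (-1) ^ y := by
  rw [h, zpow_add₀ (by norm_num), zpow_mul]
  norm_num

theorem neg_one_zpow_eq_neg {x y : ℤ} (k : ℤ) (h : x = y + 2 * k + 1) :
    (-1 : ℂ) ^ x = -(-1) ^ y := by
  rw [h, zpow_add₀ (by norm_num), zpow_add₀ (by norm_num), zpow_mul]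
  norm_num

theorem thetaCoeff_mul_zpow {q : ℂ} (hq0 : q ≠ 0) (m e : ℤ) :
    thetaCoeff q m * q ^ e = (-1) ^ m * q ^ (m * (m - 1) / 2 + e) := by
  rw [thetaCoeff, zpow_add₀ hq0]
  ring

theorem thetaCoeff_sub_mul_neg_one_zpow {q : ℂ} (hq0 : q ≠ 0) (r i e : ℤ) :
    thetaCoeff q (r - i) * ((-1) ^ i * q ^ e)
      = (-1) ^ r * q ^ ((r - i) * (r - i - 1) / 2 + e) := by
  have h : (-1 : ℂ) ^ r = (-1) ^ (r - i) * (-1) ^ i := by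
    rw [← zpow_add₀ (by norm_num), sub_add_cancel]
  rw [h, mul_left_comm, thetaCoeff_mul_zpow hq0]
  ring

/-- The exponent is quadratic in `i` with leading term `3i²/2` and vertex `r/3 - 3/2`. A shift of
`i` by `u`, with a reflection for some classes, separates `u` from the summation index; the other
convolutions work in the same way. -/
theorem theta_conv_sq_zero {q : ℂ} (hq0 : q ≠ 0) (u : ℤ) :
    ∑' i : ℤ, thetaCoeff q (3 * u - i) * ((-1) ^ i * q ^ ((i + 2) ^ 2))
      = (-1) ^ u * q ^ (3 * u ^ 2 + 3 * u + 1) * ∑' n : ℤ, (q ^ 3) ^ (n * (n + 1) / 2) := by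
  rw [← (Equiv.addRight (u - 1)).tsum_eq, ← tsum_mul_left]
  refine tsum_congr fun n => ?_
  rw [Equiv.coe_addRight, thetaCoeff_sub_mul_neg_one_zpow hq0, neg_one_zpow_three_mul, pow_zpow_eq,
    mul_assoc, ← zpow_add₀ hq0]
  congr 2
  push_cast
  linarith [even_mul_succ n, even_mul_pred (3 * u - (n + (u - 1)))]

theorem theta_conv_sq_one {q : ℂ} (hq0 : q ≠ 0) (u : ℤ) :
    ∑' i : ℤ, thetaCoeff q (3 * u + 1 - i) * ((-1) ^ i * q ^ ((i + 2) ^ 2))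
      = -(-1) ^ u * q ^ (3 * u ^ 2 + 5 * u + 2) * ∑' n : ℤ, q ^ (n * (3 * n + 1) / 2) := by
  rw [← (Equiv.addRight (u - 1)).tsum_eq, ← tsum_mul_left]
  refine tsum_congr fun n => ?_
  rw [Equiv.coe_addRight, thetaCoeff_sub_mul_neg_one_zpow hq0,
    neg_one_zpow_eq_neg (y := u) u (by ring), mul_assoc, ← zpow_add₀ hq0]
  congr 2
  have := pentagonal_mul_two n
  linarith [even_mul_pred (3 * u + 1 - (n + (u - 1)))]

theorem theta_conv_sq_neg_one {q : ℂ} (hq0 : q ≠ 0) (u : ℤ) :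
    ∑' i : ℤ, thetaCoeff q (3 * u - 1 - i) * ((-1) ^ i * q ^ ((i + 2) ^ 2))
      = -(-1) ^ u * q ^ (3 * u ^ 2 + u) * ∑' n : ℤ, q ^ (n * (3 * n + 1) / 2) := by
  rw [← (Equiv.subLeft (u - 2)).tsum_eq, ← tsum_mul_left]
  refine tsum_congr fun n => ?_
  rw [Equiv.subLeft_apply, thetaCoeff_sub_mul_neg_one_zpow hq0,
    neg_one_zpow_eq_neg (y := u) (u - 1) (by ring), mul_assoc, ← zpow_add₀ hq0]
  congr 2
  have := pentagonal_mul_two n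
  linarith [even_mul_pred (3 * u - 1 - (u - 2 - n))]

theorem thetaCoeff_sq_mul_zpow {q : ℂ} (hq0 : q ≠ 0) (m e : ℤ) :
    thetaCoeff (q ^ 2) m * q ^ e = (-1) ^ m * q ^ (m * (m - 1) + e) := by
  rw [thetaCoeff, zpow_add₀ hq0, pow_zpow_eq, mul_assoc]
  congr 3
  push_cast
  linarith [even_mul_pred m]

theorem theta_conv_pos_zero {q : ℂ} (hq0 : q ≠ 0) (u : ℤ) :
    ∑' i : ℤ, thetaCoeff (q ^ 2) (3 * u - i) * q ^ (2 * (i + 1) ^ 2 + (i + 1))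
      = -q ^ (6 * u ^ 2 + 3 * u) * ∑' n : ℤ, (-1) ^ n * (q ^ 3) ^ (n ^ 2) := by
  rw [← (Equiv.addRight (u - 1)).tsum_eq, ← tsum_mul_left]
  refine tsum_congr fun n => ?_
  rw [Equiv.coe_addRight, thetaCoeff_sq_mul_zpow hq0,
    neg_one_zpow_eq_neg (y := n) (u - n) (by ring), pow_zpow_eq, neg_mul, neg_mul, mul_left_comm,
    ← zpow_add₀ hq0]
  congr 3
  push_cast
  ring

theorem theta_conv_pos_one {q : ℂ} (hq0 : q ≠ 0) (u : ℤ) :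
    ∑' i : ℤ, thetaCoeff (q ^ 2) (3 * u + 1 - i) * q ^ (2 * (i + 1) ^ 2 + (i + 1))
      = q ^ (6 * u ^ 2 + 7 * u + 2) * ∑' n : ℤ, (-1) ^ n * q ^ (3 * n ^ 2 + 2 * n) := by
  rw [← (Equiv.subLeft (u - 1)).tsum_eq, ← tsum_mul_left]
  refine tsum_congr fun n => ?_
  rw [Equiv.subLeft_apply, thetaCoeff_sq_mul_zpow hq0,
    neg_one_zpow_eq (y := n) (u + 1) (by ring), mul_left_comm, ← zpow_add₀ hq0]
  congr 2
  ring

theorem theta_conv_pos_neg_one {q : ℂ} (hq0 : q ≠ 0) (u : ℤ) :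
    ∑' i : ℤ, thetaCoeff (q ^ 2) (3 * u - 1 - i) * q ^ (2 * (i + 1) ^ 2 + (i + 1))
      = q ^ (6 * u ^ 2 - u) * ∑' n : ℤ, (-1) ^ n * q ^ (3 * n ^ 2 + 2 * n) := by
  rw [← (Equiv.addRight (u - 1)).tsum_eq, ← tsum_mul_left]
  refine tsum_congr fun n => ?_
  rw [Equiv.coe_addRight, thetaCoeff_sq_mul_zpow hq0,
    neg_one_zpow_eq (y := n) (u - n) (by ring), mul_left_comm, ← zpow_add₀ hq0]
  congr 2
  ring

theorem theta_conv_neg_zero {q : ℂ} (hq0 : q ≠ 0) (u : ℤ) :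
    ∑' i : ℤ, thetaCoeff (q ^ 2) (3 * u - i) * q ^ (2 * (i + 1) ^ 2 - (i + 1))
      = -q ^ (6 * u ^ 2 + u) * ∑' n : ℤ, (-1) ^ n * q ^ (3 * n ^ 2 + 2 * n) := by
  rw [← (Equiv.subLeft (u - 1)).tsum_eq, ← tsum_mul_left]
  refine tsum_congr fun n => ?_
  rw [Equiv.subLeft_apply, thetaCoeff_sq_mul_zpow hq0,
    neg_one_zpow_eq_neg (y := n) u (by ring), neg_mul, neg_mul, mul_left_comm,
    ← zpow_add₀ hq0]
  congr 3
  ring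

theorem theta_conv_neg_one {q : ℂ} (hq0 : q ≠ 0) (u : ℤ) :
    ∑' i : ℤ, thetaCoeff (q ^ 2) (3 * u + 1 - i) * q ^ (2 * (i + 1) ^ 2 - (i + 1))
      = -q ^ (6 * u ^ 2 + 5 * u + 1) * ∑' n : ℤ, (-1) ^ n * q ^ (3 * n ^ 2 + 2 * n) := by
  rw [← (Equiv.addRight u).tsum_eq, ← tsum_mul_left]
  refine tsum_congr fun n => ?_
  rw [Equiv.coe_addRight, thetaCoeff_sq_mul_zpow hq0,
    neg_one_zpow_eq_neg (y := n) (u - n) (by ring), neg_mul, neg_mul, mul_left_comm,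
    ← zpow_add₀ hq0]
  congr 3
  ring

theorem theta_conv_neg_neg_one {q : ℂ} (hq0 : q ≠ 0) (u : ℤ) :
    ∑' i : ℤ, thetaCoeff (q ^ 2) (3 * u - 1 - i) * q ^ (2 * (i + 1) ^ 2 - (i + 1))
      = q ^ (6 * u ^ 2 - 3 * u) * ∑' n : ℤ, (-1) ^ n * (q ^ 3) ^ (n ^ 2) := by
  rw [← (Equiv.addRight (u - 1)).tsum_eq, ← tsum_mul_left]
  refine tsum_congr fun n => ?_
  rw [Equiv.coe_addRight, thetaCoeff_sq_mul_zpow hq0,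
    neg_one_zpow_eq (y := n) (u - n) (by ring), pow_zpow_eq, mul_left_comm, ← zpow_add₀ hq0]
  congr 2
  push_cast
  ring

/-! ### The sums over `k` as theta convolutions. -/

theorem exists_three_mul (r : ℤ) : ∃ n, r = 3 * n ∨ r = 3 * n + 1 ∨ r = 3 * n - 1 :=
  ⟨(r + 1) / 3, by omega⟩

theorem cube_zpow_eq {t : ℂ} (ht0 : t ≠ 0) {a b : ℤ} (k : ℕ) (h : a + k = 3 * b) :
    (t ^ 3) ^ b = t ^ a * t ^ k := by
  rw [pow_zpow_eq, ← zpow_natCast t k, ← zpow_add₀ ht0, h]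
  rfl

/-- The hypothesis of `hasSum_quadruple` for the first identity. The class `r ≡ 0` is the first of
the `theta_relations`; the other two classes both reduce to the second. -/
theorem tsum_sq_eq_theta_conv {t : ℂ} (ht0 : t ≠ 0) (ht : ‖t‖ < 1) (r : ℤ) :
    ∑' k : ℤ, (-1) ^ (k + r) * ((delta k : ℂ) - delta r) * t ^ (k ^ 2 + r ^ 2 + 3 * r)
      = (∑' n : ℤ, (-1) ^ n * (t ^ 3) ^ (n ^ 2)) / (t ^ 2 * qPochInf (t ^ 3) (t ^ 3))
        * ∑' i : ℤ, thetaCoeff (t ^ 3) (r - i) * ((-1) ^ i * (t ^ 3) ^ ((i + 2) ^ 2)) := by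
  have hq := norm_pow_lt_one ht three_ne_zero
  have hq0 := pow_ne_zero 3 ht0
  obtain ⟨h1, h2, -⟩ := theta_relations hq0 hq
  have hE := mul_ne_zero (pow_ne_zero 2 ht0) (qPochInf_self_ne_zero hq)
  have h : ∀ k : ℤ, (-1) ^ (k + r) * ((delta k : ℂ) - delta r) * t ^ (k ^ 2 + r ^ 2 + 3 * r)
      = (-1) ^ r * t ^ (r ^ 2 + 3 * r) * (((delta k : ℂ) - delta r) * ((-1) ^ k * t ^ (k ^ 2))) :=
    fun k => by
      rw [add_assoc, zpow_add₀ ht0 (k ^ 2), zpow_add₀ (by norm_num)]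
      ring
  rw [tsum_congr h, tsum_mul_left, tsum_delta_sub_mul_sq ht0 ht, div_mul_eq_mul_div,
    eq_div_iff hE]
  obtain ⟨u, rfl | rfl | rfl⟩ := exists_three_mul r
  · rw [delta_eq_one (n := u) rfl, theta_conv_sq_zero hq0, neg_one_zpow_three_mul,
      cube_zpow_eq ht0 (a := (3 * u) ^ 2 + 3 * (3 * u)) 3 (by push_cast; ring)]
    push_cast
    linear_combination (-1) ^ u * t ^ ((3 * u) ^ 2 + 3 * (3 * u)) * t ^ 3 * h1
  · rw [delta_eq_zero (n := u) (by simp), theta_conv_sq_one hq0,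
      neg_one_zpow_eq_neg (y := u) u (by ring),
      cube_zpow_eq ht0 (a := (3 * u + 1) ^ 2 + 3 * (3 * u + 1)) 2 (by push_cast; ring)]
    push_cast
    linear_combination -(-1) ^ u * t ^ ((3 * u + 1) ^ 2 + 3 * (3 * u + 1)) * t ^ 2 * h2
  · rw [delta_eq_zero (n := u) (by simp), theta_conv_sq_neg_one hq0,
      neg_one_zpow_eq_neg (y := u) (u - 1) (by ring),
      cube_zpow_eq ht0 (a := (3 * u - 1) ^ 2 + 3 * (3 * u - 1)) 2 (by push_cast; ring)]
    push_cast
    linear_combination -(-1) ^ u * t ^ ((3 * u - 1) ^ 2 + 3 * (3 * u - 1)) * t ^ 2 * h2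

/-- The previous convolution with `r` and `i` both lowered by one, since `r² + r = (r-1)² + 3(r-1) +
2`. -/
theorem tsum_sq_eq_theta_conv_shift {t : ℂ} (ht0 : t ≠ 0) (ht : ‖t‖ < 1) (r : ℤ) :
    ∑' k : ℤ, (-1) ^ (k + r) * ((delta k : ℂ) - delta (r - 1)) * t ^ (k ^ 2 + r ^ 2 + r)
      = (∑' n : ℤ, (-1) ^ n * (t ^ 3) ^ (n ^ 2)) / qPochInf (t ^ 3) (t ^ 3)
        * ∑' i : ℤ, thetaCoeff (t ^ 3) (r - i) * ((-1) ^ i * (t ^ 3) ^ ((i + 1) ^ 2)) := by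
  have h := tsum_sq_eq_theta_conv ht0 ht (r - 1)
  have h1 : ∀ k : ℤ, (-1) ^ (k + r) * ((delta k : ℂ) - delta (r - 1)) * t ^ (k ^ 2 + r ^ 2 + r)
      = -t ^ 2 * ((-1) ^ (k + (r - 1)) * ((delta k : ℂ) - delta (r - 1))
        * t ^ (k ^ 2 + (r - 1) ^ 2 + 3 * (r - 1))) := fun k => by
    rw [neg_one_zpow_eq_neg (x := k + r) (y := k + (r - 1)) 0 (by ring),
      show k ^ 2 + r ^ 2 + r = k ^ 2 + (r - 1) ^ 2 + 3 * (r - 1) + (2 : ℕ) by push_cast; ring,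
      zpow_add₀ ht0, zpow_natCast]
    ring
  have h2 : ∀ i : ℤ, thetaCoeff (t ^ 3) (r - 1 - (i - 1))
        * ((-1) ^ (i - 1) * (t ^ 3) ^ ((i - 1 + 2) ^ 2))
      = -(thetaCoeff (t ^ 3) (r - i) * ((-1) ^ i * (t ^ 3) ^ ((i + 1) ^ 2))) := fun i => by
    rw [neg_one_zpow_eq_neg (x := i - 1) (y := i) (-1) (by ring), sub_sub_sub_cancel_right,
      show i - 1 + 2 = i + 1 by ring]
    ring
  rw [← (Equiv.subRight (1 : ℤ)).tsum_eq fun i : ℤ => thetaCoeff (t ^ 3) (r - 1 - i)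
    * ((-1) ^ i * (t ^ 3) ^ ((i + 2) ^ 2))] at h
  simp only [Equiv.subRight_apply] at h
  rw [tsum_congr h2, tsum_neg] at h
  rw [tsum_congr h1, tsum_mul_left, h]
  have := qPochInf_self_ne_zero (norm_pow_lt_one ht three_ne_zero)
  field_simp

theorem tsum_triangular_eq_theta_conv_pos {t : ℂ} (ht0 : t ≠ 0) (ht : ‖t‖ < 1) (r : ℤ) :
    ∑' k : ℤ, ((delta (k - 1) : ℂ) - delta r) * t ^ (k * (k + 1) / 2 + 2 * r ^ 2 + 3 * r)
      = (∑' n : ℤ, (t ^ 3) ^ (n * (n + 1) / 2)) / qPochInf ((t ^ 3) ^ 2) ((t ^ 3) ^ 2)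
        * ∑' i : ℤ, thetaCoeff ((t ^ 3) ^ 2) (r - i) * (t ^ 3) ^ (2 * (i + 1) ^ 2 + (i + 1)) := by
  have hq := norm_pow_lt_one ht three_ne_zero
  have hq0 := pow_ne_zero 3 ht0
  obtain ⟨-, -, h1, h2⟩ := theta_relations hq0 hq
  have hE := qPochInf_self_ne_zero (norm_pow_lt_one hq two_ne_zero)
  have h : ∀ k : ℤ, ((delta (k - 1) : ℂ) - delta r) * t ^ (k * (k + 1) / 2 + 2 * r ^ 2 + 3 * r)
      = t ^ (2 * r ^ 2 + 3 * r) * (((delta (k - 1) : ℂ) - delta r) * t ^ (k * (k + 1) / 2)) :=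
    fun k => by
      rw [add_assoc, zpow_add₀ ht0 (k * (k + 1) / 2)]
      ring
  rw [tsum_congr h, tsum_mul_left, tsum_delta_sub_mul_triangular ht0 ht, div_mul_eq_mul_div,
    eq_div_iff hE]
  obtain ⟨u, rfl | rfl | rfl⟩ := exists_three_mul r
  · rw [delta_eq_one (n := u) rfl, theta_conv_pos_zero hq0,
      cube_zpow_eq ht0 (a := 2 * (3 * u) ^ 2 + 3 * (3 * u)) 0 (by push_cast; ring)]
    push_cast
    linear_combination -t ^ (2 * (3 * u) ^ 2 + 3 * (3 * u)) * h1
  · rw [delta_eq_zero (n := u) (by simp), theta_conv_pos_one hq0,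
      cube_zpow_eq ht0 (a := 2 * (3 * u + 1) ^ 2 + 3 * (3 * u + 1)) 1 (by push_cast; ring)]
    push_cast
    linear_combination t ^ (2 * (3 * u + 1) ^ 2 + 3 * (3 * u + 1)) * t * h2
  · rw [delta_eq_zero (n := u) (by simp), theta_conv_pos_neg_one hq0,
      cube_zpow_eq ht0 (a := 2 * (3 * u - 1) ^ 2 + 3 * (3 * u - 1)) 1 (by push_cast; ring)]
    push_cast
    linear_combination t ^ (2 * (3 * u - 1) ^ 2 + 3 * (3 * u - 1)) * t * h2

/-- The sign of the constant is harmless: it enters the quadruple sum squared. -/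
theorem tsum_triangular_eq_theta_conv_neg {t : ℂ} (ht0 : t ≠ 0) (ht : ‖t‖ < 1) (r : ℤ) :
    ∑' k : ℤ, ((delta (k - 1) : ℂ) - delta (r + 1)) * t ^ (k * (k + 1) / 2 + 2 * r ^ 2 + r - 1)
      = -(∑' n : ℤ, (t ^ 3) ^ (n * (n + 1) / 2)) / qPochInf ((t ^ 3) ^ 2) ((t ^ 3) ^ 2)
        * ∑' i : ℤ, thetaCoeff ((t ^ 3) ^ 2) (r - i) * (t ^ 3) ^ (2 * (i + 1) ^ 2 - (i + 1)) := by
  have hq := norm_pow_lt_one ht three_ne_zero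
  have hq0 := pow_ne_zero 3 ht0
  obtain ⟨-, -, h1, h2⟩ := theta_relations hq0 hq
  have hE := qPochInf_self_ne_zero (norm_pow_lt_one hq two_ne_zero)
  have h : ∀ k : ℤ, ((delta (k - 1) : ℂ) - delta (r + 1))
        * t ^ (k * (k + 1) / 2 + 2 * r ^ 2 + r - 1)
      = t ^ (2 * r ^ 2 + r - 1)
        * (((delta (k - 1) : ℂ) - delta (r + 1)) * t ^ (k * (k + 1) / 2)) :=
    fun k => by
      rw [show k * (k + 1) / 2 + 2 * r ^ 2 + r - 1 = k * (k + 1) / 2 + (2 * r ^ 2 + r - 1) by ring,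
        zpow_add₀ ht0 (k * (k + 1) / 2)]
      ring
  rw [tsum_congr h, tsum_mul_left, tsum_delta_sub_mul_triangular ht0 ht, div_mul_eq_mul_div,
    eq_div_iff hE]
  obtain ⟨u, rfl | rfl | rfl⟩ := exists_three_mul r
  · rw [delta_eq_zero (n := u) (by simp), theta_conv_neg_zero hq0,
      cube_zpow_eq ht0 (a := 2 * (3 * u) ^ 2 + 3 * u - 1) 1 (by push_cast; ring)]
    push_cast
    linear_combination t ^ (2 * (3 * u) ^ 2 + 3 * u - 1) * t * h2
  · rw [delta_eq_zero (n := u + 1) (by right; ring), theta_conv_neg_one hq0,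
      cube_zpow_eq ht0 (a := 2 * (3 * u + 1) ^ 2 + (3 * u + 1) - 1) 1 (by push_cast; ring)]
    push_cast
    linear_combination t ^ (2 * (3 * u + 1) ^ 2 + (3 * u + 1) - 1) * t * h2
  · rw [delta_eq_one (n := u) (by ring), theta_conv_neg_neg_one hq0,
      cube_zpow_eq ht0 (a := 2 * (3 * u - 1) ^ 2 + (3 * u - 1) - 1) 0 (by push_cast; ring)]
    push_cast
    linear_combination -t ^ (2 * (3 * u - 1) ^ 2 + (3 * u - 1) - 1) * h1

/-! ### The four identities for nonzero `q` -/

theorem summable_norm_of_le_mul {α : ℤ × ℤ → ℂ} {f g : ℤ → ℂ} (hf : Summable fun k => ‖f k‖)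
    (hg : Summable fun k => ‖g k‖) (h : ∀ x, ‖α x‖ ≤ ‖f x.1‖ * ‖g x.2‖) :
    Summable fun x => ‖α x‖ :=
  Summable.of_nonneg_of_le (fun _ => norm_nonneg _) h
    (hf.mul_of_nonneg hg (fun _ => norm_nonneg _) fun _ => norm_nonneg _)

theorem norm_delta_sub_mul_zpow_le {t : ℂ} (ht0 : t ≠ 0) (a b e e' : ℤ) :
    ‖((delta a : ℂ) - delta b) * t ^ (e + e')‖ ≤ ‖t ^ e‖ * ‖t ^ e'‖ := by
  rw [norm_mul, zpow_add₀ ht0, norm_mul]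
  exact mul_le_of_le_one_left (by positivity) (norm_delta_sub_delta_le a b)

theorem summable_norm_zpow_sq {t : ℂ} (ht0 : t ≠ 0) (ht : ‖t‖ < 1) :
    Summable fun k : ℤ => ‖t ^ (k ^ 2)‖ :=
  summable_norm_zpow ht0 ht 0 0 (fun k => k ^ 2) fun n => by
    nlinarith [even_mul_pred n, sq_nonneg (n + 1), sq_nonneg n]

theorem summable_norm_zpow_triangular {t : ℂ} (ht0 : t ≠ 0) (ht : ‖t‖ < 1) :
    Summable fun k : ℤ => ‖t ^ (k * (k + 1) / 2)‖ :=
  summable_norm_zpow ht0 ht 1 0 (fun k => k * (k + 1) / 2) fun n => by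
    linarith [even_mul_pred n, even_mul_succ n]

theorem hasSum_hecke_one {t : ℂ} (ht0 : t ≠ 0) (ht : ‖t‖ < 1) :
    HasSum
      (fun x =>
        (rho x.2.2.1 x.2.2.2 : ℂ) * (-1 : ℂ) ^ (x.1 + x.2.1 + x.2.2.1 + x.2.2.2)
          * ((delta x.1 : ℂ) - (delta x.2.2.1 : ℂ)) * ((delta x.2.1 : ℂ) - (delta x.2.2.2 : ℂ))
          * t ^ (x.1 ^ 2 + x.2.1 ^ 2 + x.2.2.1 ^ 2 + 3 * x.2.2.1 * x.2.2.2 + x.2.2.2 ^ 2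
            + 3 * x.2.2.1 + 3 * x.2.2.2 + 1) :
        ℤ × ℤ × ℤ × ℤ → ℂ)
      (-(qPochInf (t ^ 3) (t ^ 3) * (∑' n : ℤ, (-1 : ℂ) ^ n * (t ^ 3) ^ (n ^ 2)) ^ 2
          * ∑' n : ℤ, (-1 : ℂ) ^ n * (t ^ 3) ^ ((5 * n ^ 2 + 3 * n) / 2))) := by
  have hq := norm_pow_lt_one ht three_ne_zero
  have hq0 := pow_ne_zero 3 ht0
  have hE := qPochInf_self_ne_zero hq
  have hα : Summable fun x : ℤ × ℤ => ‖(-1) ^ (x.1 + x.2) * ((delta x.1 : ℂ) - delta x.2)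
      * t ^ (x.1 ^ 2 + x.2 ^ 2 + 3 * x.2)‖ := by
    refine summable_norm_of_le_mul (summable_norm_zpow_sq ht0 ht)
      -- Completing the square requires a constant at least `49/8`.
      (summable_norm_zpow ht0 ht 0 7 (fun r => r ^ 2 + 3 * r) fun n => by
        nlinarith [even_mul_pred n, sq_nonneg (2 * n + 7)]) fun x => ?_
    rw [mul_assoc, norm_mul, norm_neg_one_zpow, one_mul, add_assoc]
    exact norm_delta_sub_mul_zpow_le ht0 _ _ _ _
  have hh : Summable fun i : ℤ => ‖(-1) ^ i * (t ^ 3) ^ ((i + 2) ^ 2)‖ := by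
    simpa [Function.comp_def] using
      (summable_norm_zpow_sq hq0 hq).comp_injective (Equiv.addRight (2 : ℤ)).injective
  -- The factor `t` is the `+ 1` in the exponent. It later combines with `(1 / t ^ 2) ^ 2` and the
  -- `t ^ 3` of `hv` to give `1`.
  have h := (hasSum_quadruple hq0 hq _ hα hh (tsum_sq_eq_theta_conv ht0 ht)).mul_left t
  have hv : ∑' i : ℤ, (-1) ^ i * (t ^ 3) ^ (i * (i + 1) / 2)
        * ((-1) ^ i * (t ^ 3) ^ ((i + 2) ^ 2)) ^ 2
      = t ^ 3 * ∑' n : ℤ, (-1 : ℂ) ^ n * (t ^ 3) ^ ((5 * n ^ 2 + 3 * n) / 2) := by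
    -- With `i = -2 - n` the exponent `i(i+1)/2 + 2(i+2)²` becomes `(5n² + 3n)/2 + 1`.
    rw [← (Equiv.subLeft (-2 : ℤ)).tsum_eq, ← tsum_mul_left]
    refine tsum_congr fun n => ?_
    have e2 : (5 * n ^ 2 + 3 * n) / 2 * 2 = 5 * n ^ 2 + 3 * n :=
      Int.ediv_mul_cancel ⟨n * (n + 1) / 2 + 2 * n ^ 2 + n, by linarith [even_mul_succ n]⟩
    rw [Equiv.subLeft_apply, mul_pow, ← zpow_natCast _ 2, ← zpow_natCast _ 2, ← zpow_mul,
      ← zpow_mul, neg_one_zpow_eq (x := -2 - n) (y := n) (-n - 1) (by ring),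
      neg_one_zpow_eq (x := (-2 - n) * (2 : ℕ)) (y := 0) (-2 - n) (by push_cast; ring),
        zpow_zero, one_mul,
      mul_assoc, ← zpow_add₀ hq0, mul_left_comm, ← zpow_one_add₀ hq0]
    congr 2
    push_cast
    linarith [even_mul_succ (-2 - n)]
  rw [hv] at h
  have e : -(qPochInf (t ^ 3) (t ^ 3) * (∑' n : ℤ, (-1 : ℂ) ^ n * (t ^ 3) ^ (n ^ 2)) ^ 2
          * ∑' n : ℤ, (-1 : ℂ) ^ n * (t ^ 3) ^ ((5 * n ^ 2 + 3 * n) / 2))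
      = t * (-qPochInf (t ^ 3) (t ^ 3) ^ 3 * ((∑' n : ℤ, (-1) ^ n * (t ^ 3) ^ (n ^ 2))
        / (t ^ 2 * qPochInf (t ^ 3) (t ^ 3))) ^ 2 * (t ^ 3
          * ∑' n : ℤ, (-1 : ℂ) ^ n * (t ^ 3) ^ ((5 * n ^ 2 + 3 * n) / 2))) := by
    field_simp
  rw [e]
  refine h.congr_fun ?_
  rintro ⟨k, l, r, s⟩
  dsimp only
  rw [show k + l + r + s = (k + r) + (l + s) by ring, zpow_add₀ (by norm_num) (k + r),
    show k ^ 2 + l ^ 2 + r ^ 2 + 3 * r * s + s ^ 2 + 3 * r + 3 * s + 1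
      = (3 : ℕ) * (r * s) + (k ^ 2 + r ^ 2 + 3 * r) + (l ^ 2 + s ^ 2 + 3 * s) + 1 by
        push_cast; ring,
    zpow_add_one₀ ht0, zpow_add₀ ht0, zpow_add₀ ht0, ← pow_zpow_eq]
  ring

theorem hasSum_hecke_two {t : ℂ} (ht0 : t ≠ 0) (ht : ‖t‖ < 1) :
    HasSum
      (fun x =>
        (rho x.2.2.1 x.2.2.2 : ℂ) * (-1 : ℂ) ^ (x.1 + x.2.1 + x.2.2.1 + x.2.2.2)
          * ((delta x.1 : ℂ) - (delta (x.2.2.1 - 1) : ℂ))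
            * ((delta x.2.1 : ℂ) - (delta (x.2.2.2 - 1) : ℂ))
          * t ^ (x.1 ^ 2 + x.2.1 ^ 2 + x.2.2.1 ^ 2 + 3 * x.2.2.1 * x.2.2.2 + x.2.2.2 ^ 2
            + x.2.2.1 + x.2.2.2) :
        ℤ × ℤ × ℤ × ℤ → ℂ)
      (qPochInf (t ^ 3) (t ^ 3) * (∑' n : ℤ, (-1 : ℂ) ^ n * (t ^ 3) ^ (n ^ 2)) ^ 2
          * ∑' n : ℤ, (-1 : ℂ) ^ n * (t ^ 3) ^ ((5 * n ^ 2 + n) / 2)) := by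
  have hq := norm_pow_lt_one ht three_ne_zero
  have hq0 := pow_ne_zero 3 ht0
  have hE := qPochInf_self_ne_zero hq
  have hα : Summable fun x : ℤ × ℤ => ‖(-1) ^ (x.1 + x.2) * ((delta x.1 : ℂ) - delta (x.2 - 1))
      * t ^ (x.1 ^ 2 + x.2 ^ 2 + x.2)‖ := by
    refine summable_norm_of_le_mul (summable_norm_zpow_sq ht0 ht)
      (summable_norm_zpow ht0 ht 0 7 (fun r => r ^ 2 + r) fun n => by
        nlinarith [even_mul_pred n, sq_nonneg (2 * n + 3)]) fun x => ?_
    rw [mul_assoc, norm_mul, norm_neg_one_zpow, one_mul, add_assoc]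
    exact norm_delta_sub_mul_zpow_le ht0 _ _ _ _
  have hh : Summable fun i : ℤ => ‖(-1) ^ i * (t ^ 3) ^ ((i + 1) ^ 2)‖ := by
    simpa [Function.comp_def] using
      (summable_norm_zpow_sq hq0 hq).comp_injective (Equiv.addRight (1 : ℤ)).injective
  have h := hasSum_quadruple hq0 hq _ hα hh (tsum_sq_eq_theta_conv_shift ht0 ht)
  have hv : ∑' i : ℤ, (-1) ^ i * (t ^ 3) ^ (i * (i + 1) / 2)
        * ((-1) ^ i * (t ^ 3) ^ ((i + 1) ^ 2)) ^ 2
      = -∑' n : ℤ, (-1 : ℂ) ^ n * (t ^ 3) ^ ((5 * n ^ 2 + n) / 2) := by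
    -- With `i = -1 - n` the exponent is `(5n² + n)/2`; the sign `(-1)^{n+1}` cancels that of
    -- `-(q;q)_∞^3`.
    rw [← (Equiv.subLeft (-1 : ℤ)).tsum_eq, ← tsum_neg]
    refine tsum_congr fun n => ?_
    have e2 : (5 * n ^ 2 + n) / 2 * 2 = 5 * n ^ 2 + n :=
      Int.ediv_mul_cancel ⟨n * (n + 1) / 2 + 2 * n ^ 2, by linarith [even_mul_succ n]⟩
    rw [Equiv.subLeft_apply, mul_pow, ← zpow_natCast _ 2, ← zpow_natCast _ 2, ← zpow_mul,
      ← zpow_mul, neg_one_zpow_eq_neg (x := -1 - n) (y := n) (-n - 1) (by ring),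
      neg_one_zpow_eq (x := (-1 - n) * (2 : ℕ)) (y := 0) (-1 - n) (by push_cast; ring), zpow_zero,
      one_mul, mul_assoc, ← zpow_add₀ hq0, neg_mul]
    congr 3
    push_cast
    linarith [even_mul_succ (-1 - n)]
  rw [hv] at h
  have e : qPochInf (t ^ 3) (t ^ 3) * (∑' n : ℤ, (-1 : ℂ) ^ n * (t ^ 3) ^ (n ^ 2)) ^ 2
          * ∑' n : ℤ, (-1 : ℂ) ^ n * (t ^ 3) ^ ((5 * n ^ 2 + n) / 2)
      = -qPochInf (t ^ 3) (t ^ 3) ^ 3 * ((∑' n : ℤ, (-1) ^ n * (t ^ 3) ^ (n ^ 2))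
        / qPochInf (t ^ 3) (t ^ 3)) ^ 2
          * -∑' n : ℤ, (-1 : ℂ) ^ n * (t ^ 3) ^ ((5 * n ^ 2 + n) / 2) := by
    field_simp
  rw [e]
  refine h.congr_fun ?_
  rintro ⟨k, l, r, s⟩
  dsimp only
  rw [show k + l + r + s = (k + r) + (l + s) by ring, zpow_add₀ (by norm_num) (k + r),
    show k ^ 2 + l ^ 2 + r ^ 2 + 3 * r * s + s ^ 2 + r + s
      = (3 : ℕ) * (r * s) + (k ^ 2 + r ^ 2 + r) + (l ^ 2 + s ^ 2 + s) by
        push_cast; ring,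
    zpow_add₀ ht0, zpow_add₀ ht0, ← pow_zpow_eq]
  ring

theorem hasSum_hecke_three {t : ℂ} (ht0 : t ≠ 0) (ht : ‖t‖ < 1) :
    HasSum
      (fun x =>
        (rho x.2.2.1 x.2.2.2 : ℂ)
          * ((delta (x.1 - 1) : ℂ) - (delta x.2.2.1 : ℂ))
            * ((delta (x.2.1 - 1) : ℂ) - (delta x.2.2.2 : ℂ))
          * t ^ (x.1 * (x.1 + 1) / 2 + x.2.1 * (x.2.1 + 1) / 2 + 2 * x.2.2.1 ^ 2
            + 6 * x.2.2.1 * x.2.2.2 + 2 * x.2.2.2 ^ 2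
              + 3 * x.2.2.1 + 3 * x.2.2.2) :
        ℤ × ℤ × ℤ × ℤ → ℂ)
      (qPochInf ((t ^ 3) ^ 2) ((t ^ 3) ^ 2) * (∑' n : ℤ, (t ^ 3) ^ (n * (n + 1) / 2)) ^ 2
          * ∑' n : ℤ, (-1 : ℂ) ^ n * (t ^ 3) ^ (5 * n ^ 2 + n)) := by
  have hq := norm_pow_lt_one ht three_ne_zero
  have hq0 := pow_ne_zero 3 ht0
  have hQ := norm_pow_lt_one hq two_ne_zero
  have hE := qPochInf_self_ne_zero hQ
  have hα : Summable fun x : ℤ × ℤ => ‖((delta (x.1 - 1) : ℂ) - delta x.2)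
      * t ^ (x.1 * (x.1 + 1) / 2 + 2 * x.2 ^ 2 + 3 * x.2)‖ := by
    refine summable_norm_of_le_mul (summable_norm_zpow_triangular ht0 ht)
      (summable_norm_zpow ht0 ht 0 7 (fun r => 2 * r ^ 2 + 3 * r) fun n => by
        nlinarith [even_mul_pred n, sq_nonneg (2 * n + 3)]) fun x => ?_
    rw [add_assoc]
    exact norm_delta_sub_mul_zpow_le ht0 _ _ _ _
  have hh : Summable fun i : ℤ => ‖(t ^ 3) ^ (2 * (i + 1) ^ 2 + (i + 1))‖ :=
    summable_norm_zpow hq0 hq 0 7 (fun i => 2 * (i + 1) ^ 2 + (i + 1)) fun n => by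
      nlinarith [even_mul_pred n, sq_nonneg (n + 2)]
  have h := hasSum_quadruple (pow_ne_zero 2 hq0) hQ _ hα hh
    (tsum_triangular_eq_theta_conv_pos ht0 ht)
  have hv : ∑' i : ℤ, (-1) ^ i * ((t ^ 3) ^ 2) ^ (i * (i + 1) / 2)
        * ((t ^ 3) ^ (2 * (i + 1) ^ 2 + (i + 1))) ^ 2
      = -∑' n : ℤ, (-1 : ℂ) ^ n * (t ^ 3) ^ (5 * n ^ 2 + n) := by
    rw [← (Equiv.subRight (1 : ℤ)).tsum_eq, ← tsum_neg]
    refine tsum_congr fun n => ?_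
    rw [Equiv.subRight_apply, ← zpow_natCast _ 2, ← zpow_natCast _ 2, ← zpow_mul, ← zpow_mul,
      neg_one_zpow_eq_neg (x := n - 1) (y := n) (-1) (by ring), mul_assoc, ← zpow_add₀ hq0,
      neg_mul]
    congr 3
    push_cast
    linarith [even_mul_succ (n - 1)]
  rw [hv] at h
  have e : qPochInf ((t ^ 3) ^ 2) ((t ^ 3) ^ 2) * (∑' n : ℤ, (t ^ 3) ^ (n * (n + 1) / 2)) ^ 2
          * ∑' n : ℤ, (-1 : ℂ) ^ n * (t ^ 3) ^ (5 * n ^ 2 + n)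
      = -qPochInf ((t ^ 3) ^ 2) ((t ^ 3) ^ 2) ^ 3 * ((∑' n : ℤ, (t ^ 3) ^ (n * (n + 1) / 2))
        / qPochInf ((t ^ 3) ^ 2) ((t ^ 3) ^ 2)) ^ 2
          * -∑' n : ℤ, (-1 : ℂ) ^ n * (t ^ 3) ^ (5 * n ^ 2 + n) := by
    field_simp
  rw [e]
  refine h.congr_fun ?_
  rintro ⟨k, l, r, s⟩
  dsimp only
  rw [show k * (k + 1) / 2 + l * (l + 1) / 2 + 2 * r ^ 2 + 6 * r * s + 2 * s ^ 2 + 3 * r + 3 * s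
      = (3 * 2 : ℕ) * (r * s) + (k * (k + 1) / 2 + 2 * r ^ 2 + 3 * r)
        + (l * (l + 1) / 2 + 2 * s ^ 2 + 3 * s) by push_cast; ring,
    zpow_add₀ ht0, zpow_add₀ ht0, ← pow_zpow_eq, pow_mul]
  ring

theorem hasSum_hecke_four {t : ℂ} (ht0 : t ≠ 0) (ht : ‖t‖ < 1) :
    HasSum
      (fun x =>
        (rho x.2.2.1 x.2.2.2 : ℂ)
          * ((delta (x.1 - 1) : ℂ) - (delta (x.2.2.1 + 1) : ℂ))
          * ((delta (x.2.1 - 1) : ℂ) - (delta (x.2.2.2 + 1) : ℂ))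
          * t ^ (x.1 * (x.1 + 1) / 2 + x.2.1 * (x.2.1 + 1) / 2 + 2 * x.2.2.1 ^ 2
            + 6 * x.2.2.1 * x.2.2.2 + 2 * x.2.2.2 ^ 2
              + x.2.2.1 + x.2.2.2 - 2) :
        ℤ × ℤ × ℤ × ℤ → ℂ)
      (qPochInf ((t ^ 3) ^ 2) ((t ^ 3) ^ 2) * (∑' n : ℤ, (t ^ 3) ^ (n * (n + 1) / 2)) ^ 2
          * ∑' n : ℤ, (-1 : ℂ) ^ n * (t ^ 3) ^ (5 * n ^ 2 + 3 * n)) := by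
  have hq := norm_pow_lt_one ht three_ne_zero
  have hq0 := pow_ne_zero 3 ht0
  have hQ := norm_pow_lt_one hq two_ne_zero
  have hE := qPochInf_self_ne_zero hQ
  have hα : Summable fun x : ℤ × ℤ => ‖((delta (x.1 - 1) : ℂ) - delta (x.2 + 1))
      * t ^ (x.1 * (x.1 + 1) / 2 + 2 * x.2 ^ 2 + x.2 - 1)‖ := by
    refine summable_norm_of_le_mul (summable_norm_zpow_triangular ht0 ht)
      (summable_norm_zpow ht0 ht 0 7 (fun r => 2 * r ^ 2 + r - 1) fun n => by
        nlinarith [even_mul_pred n, sq_nonneg (2 * n + 3)]) fun x => ?_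
    rw [add_assoc, add_sub_assoc]
    exact norm_delta_sub_mul_zpow_le ht0 _ _ _ _
  have hh : Summable fun i : ℤ => ‖(t ^ 3) ^ (2 * (i + 1) ^ 2 - (i + 1))‖ :=
    summable_norm_zpow hq0 hq 0 7 (fun i => 2 * (i + 1) ^ 2 - (i + 1)) fun n => by
      nlinarith [even_mul_pred n, sq_nonneg (n + 2)]
  have h := hasSum_quadruple (pow_ne_zero 2 hq0) hQ _ hα hh
    (tsum_triangular_eq_theta_conv_neg ht0 ht)
  have hv : ∑' i : ℤ, (-1) ^ i * ((t ^ 3) ^ 2) ^ (i * (i + 1) / 2)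
        * ((t ^ 3) ^ (2 * (i + 1) ^ 2 - (i + 1))) ^ 2
      = -∑' n : ℤ, (-1 : ℂ) ^ n * (t ^ 3) ^ (5 * n ^ 2 + 3 * n) := by
    rw [← (Equiv.subLeft (-1 : ℤ)).tsum_eq, ← tsum_neg]
    refine tsum_congr fun n => ?_
    rw [Equiv.subLeft_apply, ← zpow_natCast _ 2, ← zpow_natCast _ 2, ← zpow_mul, ← zpow_mul,
      neg_one_zpow_eq_neg (x := -1 - n) (y := n) (-n - 1) (by ring), mul_assoc, ← zpow_add₀ hq0,
      neg_mul]
    congr 3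
    push_cast
    linarith [even_mul_succ (-1 - n)]
  rw [hv] at h
  have e : qPochInf ((t ^ 3) ^ 2) ((t ^ 3) ^ 2) * (∑' n : ℤ, (t ^ 3) ^ (n * (n + 1) / 2)) ^ 2
          * ∑' n : ℤ, (-1 : ℂ) ^ n * (t ^ 3) ^ (5 * n ^ 2 + 3 * n)
      = -qPochInf ((t ^ 3) ^ 2) ((t ^ 3) ^ 2) ^ 3 * (-(∑' n : ℤ, (t ^ 3) ^ (n * (n + 1) / 2))
        / qPochInf ((t ^ 3) ^ 2) ((t ^ 3) ^ 2)) ^ 2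
          * -∑' n : ℤ, (-1 : ℂ) ^ n * (t ^ 3) ^ (5 * n ^ 2 + 3 * n) := by
    field_simp
  rw [e]
  refine h.congr_fun ?_
  rintro ⟨k, l, r, s⟩
  dsimp only
  rw [show k * (k + 1) / 2 + l * (l + 1) / 2 + 2 * r ^ 2 + 6 * r * s + 2 * s ^ 2 + r + s - 2
      = (3 * 2 : ℕ) * (r * s) + (k * (k + 1) / 2 + 2 * r ^ 2 + r - 1)
        + (l * (l + 1) / 2 + 2 * s ^ 2 + s - 1) by push_cast; ring,
    zpow_add₀ ht0, zpow_add₀ ht0, ← pow_zpow_eq, pow_mul]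
  ring

/-! ### The case `q = 0` -/

theorem rho_cases (r s : ℤ) :
    (0 ≤ r ∧ 0 ≤ s) ∨ (r ≤ -1 ∧ s ≤ -1) ∨ rho r s = 0 := by
  unfold rho
  split_ifs <;> omega

theorem qPochInf_zero : qPochInf 0 0 = 1 := by
  simp [qPochInf]

/-- Since `0 ^ m = 0` for every nonzero integer `m`, negative ones included, only terms with
exponent exactly `0` count at `q = 0`. -/
theorem tsum_zero_zpow {c : ℤ → ℂ} {e : ℤ → ℤ} (h0 : e 0 = 0) (hc : c 0 = 1)
    (h : ∀ n, e n = 0 → n = 0) : ∑' n, c n * (0 : ℂ) ^ e n = 1 := by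
  rw [tsum_eq_single 0 fun n hn => by rw [zero_zpow _ (mt (h n) hn), mul_zero], h0, hc]
  simp

theorem triangular_nonneg (n : ℤ) : 0 ≤ n * (n + 1) / 2 := by
  have := even_mul_succ n
  rcases le_or_gt 0 n with h | h <;> nlinarith

theorem triangular_eq_zero {n : ℤ} (h : n * (n + 1) / 2 = 0) : n = 0 ∨ n = -1 := by
  have h1 := even_mul_succ n
  rw [h, zero_mul, eq_comm, mul_eq_zero] at h1
  omega

theorem tsum_zero_zpow_triangular : ∑' n : ℤ, (0 : ℂ) ^ (n * (n + 1) / 2) = 2 := by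
  rw [tsum_eq_sum (s := {0, -1}) fun n hn => zero_zpow _ fun h => hn (by
    simpa using triangular_eq_zero h)]
  norm_num

theorem hasSum_hecke_one_zero :
    HasSum
      (fun x =>
        (rho x.2.2.1 x.2.2.2 : ℂ) * (-1 : ℂ) ^ (x.1 + x.2.1 + x.2.2.1 + x.2.2.2)
          * ((delta x.1 : ℂ) - (delta x.2.2.1 : ℂ)) * ((delta x.2.1 : ℂ) - (delta x.2.2.2 : ℂ))
          * 0 ^ (x.1 ^ 2 + x.2.1 ^ 2 + x.2.2.1 ^ 2 + 3 * x.2.2.1 * x.2.2.2 + x.2.2.2 ^ 2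
            + 3 * x.2.2.1 + 3 * x.2.2.2 + 1) :
        ℤ × ℤ × ℤ × ℤ → ℂ) (-1) := by
  convert hasSum_single ((0, 0, -1, -1) : ℤ × ℤ × ℤ × ℤ) ?_ using 1
  · simp [rho, delta, Int.ModEq]
  · rintro ⟨k, l, r, s⟩ hne
    dsimp only
    rcases rho_cases r s with ⟨hr, hs⟩ | ⟨hr, hs⟩ | h
    · rw [zero_zpow _ (by positivity), mul_zero]
    · by_cases he : k ^ 2 + l ^ 2 + r ^ 2 + 3 * r * s + s ^ 2 + 3 * r + 3 * s + 1 = 0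
      -- With `a = -1 - r` and `b = -1 - s` the exponent is `k² + l² + a² + 3ab + b² + 2a + 2b`,
      -- zero only at the origin.
      · have h1 : 0 ≤ (-1 - r) * (-1 - s) := mul_nonneg (by linarith) (by linarith)
        have hk : k = 0 := by
          nlinarith [sq_nonneg k, sq_nonneg l, sq_nonneg (r + 1), sq_nonneg (s + 1)]
        have hl : l = 0 := by
          nlinarith [sq_nonneg k, sq_nonneg l, sq_nonneg (r + 1), sq_nonneg (s + 1)]
        have hr' : r = -1 := by
          nlinarith [sq_nonneg k, sq_nonneg l, sq_nonneg (r + 1), sq_nonneg (s + 1)]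
        have hs' : s = -1 := by
          nlinarith [sq_nonneg k, sq_nonneg l, sq_nonneg (r + 1), sq_nonneg (s + 1)]
        exact absurd (by rw [hk, hl, hr', hs']) hne
      · rw [zero_zpow _ he, mul_zero]
    · simp [h]

theorem hasSum_hecke_two_zero :
    HasSum
      (fun x =>
        (rho x.2.2.1 x.2.2.2 : ℂ) * (-1 : ℂ) ^ (x.1 + x.2.1 + x.2.2.1 + x.2.2.2)
          * ((delta x.1 : ℂ) - (delta (x.2.2.1 - 1) : ℂ))
            * ((delta x.2.1 : ℂ) - (delta (x.2.2.2 - 1) : ℂ))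
          * 0 ^ (x.1 ^ 2 + x.2.1 ^ 2 + x.2.2.1 ^ 2 + 3 * x.2.2.1 * x.2.2.2 + x.2.2.2 ^ 2
            + x.2.2.1 + x.2.2.2) :
        ℤ × ℤ × ℤ × ℤ → ℂ) 1 := by
  convert hasSum_single ((0, 0, 0, 0) : ℤ × ℤ × ℤ × ℤ) ?_ using 1
  · simp [rho, delta, Int.ModEq]
  · rintro ⟨k, l, r, s⟩ hne
    dsimp only
    rcases rho_cases r s with ⟨hr, hs⟩ | ⟨hr, hs⟩ | h
    · by_cases he : k ^ 2 + l ^ 2 + r ^ 2 + 3 * r * s + s ^ 2 + r + s = 0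
      · have h1 : 0 ≤ r * s := mul_nonneg hr hs
        have hk : k = 0 := by nlinarith [sq_nonneg k, sq_nonneg l, sq_nonneg r, sq_nonneg s]
        have hl : l = 0 := by nlinarith [sq_nonneg k, sq_nonneg l, sq_nonneg r, sq_nonneg s]
        have hr' : r = 0 := by nlinarith [sq_nonneg k, sq_nonneg l, sq_nonneg r, sq_nonneg s]
        have hs' : s = 0 := by nlinarith [sq_nonneg k, sq_nonneg l, sq_nonneg r, sq_nonneg s]
        exact absurd (by rw [hk, hl, hr', hs']) hne
      · rw [zero_zpow _ he, mul_zero]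
    · have h1 : 0 ≤ (-1 - r) * (-1 - s) := mul_nonneg (by linarith) (by linarith)
      have he : 0 < k ^ 2 + l ^ 2 + r ^ 2 + 3 * r * s + s ^ 2 + r + s := by
        nlinarith [sq_nonneg k, sq_nonneg l, sq_nonneg (r + 1), sq_nonneg (s + 1)]
      rw [zero_zpow _ he.ne', mul_zero]
    · simp [h]

theorem hasSum_hecke_three_zero :
    HasSum
      (fun x =>
        (rho x.2.2.1 x.2.2.2 : ℂ)
          * ((delta (x.1 - 1) : ℂ) - (delta x.2.2.1 : ℂ))
            * ((delta (x.2.1 - 1) : ℂ) - (delta x.2.2.2 : ℂ))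
          * 0 ^ (x.1 * (x.1 + 1) / 2 + x.2.1 * (x.2.1 + 1) / 2 + 2 * x.2.2.1 ^ 2
            + 6 * x.2.2.1 * x.2.2.2 + 2 * x.2.2.2 ^ 2
              + 3 * x.2.2.1 + 3 * x.2.2.2) :
        ℤ × ℤ × ℤ × ℤ → ℂ) (2 ^ 2) := by
  convert hasSum_sum_of_ne_finset_zero (L := .unconditional (ℤ × ℤ × ℤ × ℤ))
    (s := ({0, -1} : Finset ℤ) ×ˢ ({0, -1} : Finset ℤ) ×ˢ ({0} : Finset ℤ) ×ˢ ({0} : Finset ℤ))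
    ?_ using 1
  · simp [Finset.sum_product, rho, delta, Int.ModEq]
    norm_num
  · rintro ⟨k, l, r, s⟩ hne
    dsimp only
    have hk := triangular_nonneg k
    have hl := triangular_nonneg l
    rcases rho_cases r s with ⟨hr, hs⟩ | ⟨hr, hs⟩ | h
    · by_cases he : k * (k + 1) / 2 + l * (l + 1) / 2 + 2 * r ^ 2 + 6 * r * s + 2 * s ^ 2
              + 3 * r + 3 * s = 0
      · have h1 : 0 ≤ r * s := mul_nonneg hr hs
        have hk' := triangular_eq_zero (n := k) (by nlinarith [sq_nonneg r, sq_nonneg s])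
        have hl' := triangular_eq_zero (n := l) (by nlinarith [sq_nonneg r, sq_nonneg s])
        have hr' : r = 0 := by nlinarith [sq_nonneg r, sq_nonneg s]
        have hs' : s = 0 := by nlinarith [sq_nonneg r, sq_nonneg s]
        exact absurd (by simp [hk', hl', hr', hs']) hne
      · rw [zero_zpow _ he, mul_zero]
    · have h1 : 0 ≤ (-1 - r) * (-1 - s) := mul_nonneg (by linarith) (by linarith)
      have he : 0 < k * (k + 1) / 2 + l * (l + 1) / 2 + 2 * r ^ 2 + 6 * r * s + 2 * s ^ 2
              + 3 * r + 3 * s := by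
        nlinarith [sq_nonneg (r + 1), sq_nonneg (s + 1)]
      rw [zero_zpow _ he.ne', mul_zero]
    · simp [h]

/-- Since `2` is not triangular, both summands must be `1`. This locates the four terms of the last
identity at `q = 0`. -/
theorem eq_of_triangular_add_eq_two {k l : ℤ} (h : k * (k + 1) / 2 + l * (l + 1) / 2 = 2) :
    k = 1 ∨ k = -2 := by
  have h1 := triangular_nonneg k
  have h2 := triangular_nonneg l
  have hk := even_mul_succ k
  have hl := even_mul_succ l
  have k1 : k ≤ 1 := by nlinarith
  have k2 : -2 ≤ k := by nlinarith
  have l1 : l ≤ 1 := by nlinarith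
  have l2 : -2 ≤ l := by nlinarith
  interval_cases k <;> interval_cases l <;> simp_all

theorem hasSum_hecke_four_zero :
    HasSum
      (fun x =>
        (rho x.2.2.1 x.2.2.2 : ℂ)
          * ((delta (x.1 - 1) : ℂ) - (delta (x.2.2.1 + 1) : ℂ))
          * ((delta (x.2.1 - 1) : ℂ) - (delta (x.2.2.2 + 1) : ℂ))
          * 0 ^ (x.1 * (x.1 + 1) / 2 + x.2.1 * (x.2.1 + 1) / 2 + 2 * x.2.2.1 ^ 2
            + 6 * x.2.2.1 * x.2.2.2 + 2 * x.2.2.2 ^ 2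
              + x.2.2.1 + x.2.2.2 - 2) :
        ℤ × ℤ × ℤ × ℤ → ℂ) (2 ^ 2) := by
  convert hasSum_sum_of_ne_finset_zero (L := .unconditional (ℤ × ℤ × ℤ × ℤ))
    (s := ({1, -2} : Finset ℤ) ×ˢ ({1, -2} : Finset ℤ) ×ˢ ({0} : Finset ℤ) ×ˢ ({0} : Finset ℤ))
    ?_ using 1
  · simp [Finset.sum_product, rho, delta, Int.ModEq]
    norm_num
  · rintro ⟨k, l, r, s⟩ hne
    dsimp only
    have hk := triangular_nonneg k
    have hl := triangular_nonneg l
    rcases rho_cases r s with ⟨hr, hs⟩ | ⟨hr, hs⟩ | h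
    · by_cases he : k * (k + 1) / 2 + l * (l + 1) / 2 + 2 * r ^ 2 + 6 * r * s + 2 * s ^ 2
              + r + s - 2 = 0
      · have h1 : 0 ≤ r * s := mul_nonneg hr hs
        have hr' : r = 0 := by nlinarith [sq_nonneg s]
        have hs' : s = 0 := by nlinarith [sq_nonneg r]
        subst hr' hs'
        have hk' := eq_of_triangular_add_eq_two (k := k) (l := l) (by linarith)
        have hl' := eq_of_triangular_add_eq_two (k := l) (l := k) (by linarith)
        exact absurd (by simp [hk', hl']) hne
      · rw [zero_zpow _ he, mul_zero]
    · have h1 : 0 ≤ (-1 - r) * (-1 - s) := mul_nonneg (by linarith) (by linarith)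
      have he : 0 < k * (k + 1) / 2 + l * (l + 1) / 2 + 2 * r ^ 2 + 6 * r * s + 2 * s ^ 2
              + r + s - 2 := by
        nlinarith [sq_nonneg (r + 1), sq_nonneg (s + 1)]
      rw [zero_zpow _ he.ne', mul_zero]
    · simp [h]

theorem theorem1p1 (q t : ℂ) (hq : ‖q‖ < 1) (ht : t ^ 3 = q) :
    HasSum
      (fun (k, l, r, s) =>
        (rho r s : ℂ) * (-1 : ℂ) ^ (k + l + r + s)
          * ((delta k : ℂ) - (delta r : ℂ)) * ((delta l : ℂ) - (delta s : ℂ))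
          * t ^ (k ^ 2 + l ^ 2 + r ^ 2 + 3 * r * s + s ^ 2 + 3 * r + 3 * s + 1) :
        ℤ × ℤ × ℤ × ℤ → ℂ)
      (-(qPochInf q q * (∑' n : ℤ, (-1 : ℂ) ^ n * q ^ (n ^ 2)) ^ 2
          * ∑' n : ℤ, (-1 : ℂ) ^ n * q ^ ((5 * n ^ 2 + 3 * n) / 2)))
    ∧ HasSum
      (fun (k, l, r, s) =>
        (rho r s : ℂ) * (-1 : ℂ) ^ (k + l + r + s)
          * ((delta k : ℂ) - (delta (r - 1) : ℂ)) * ((delta l : ℂ) - (delta (s - 1) : ℂ))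
          * t ^ (k ^ 2 + l ^ 2 + r ^ 2 + 3 * r * s + s ^ 2 + r + s) :
        ℤ × ℤ × ℤ × ℤ → ℂ)
      (qPochInf q q * (∑' n : ℤ, (-1 : ℂ) ^ n * q ^ (n ^ 2)) ^ 2
          * ∑' n : ℤ, (-1 : ℂ) ^ n * q ^ ((5 * n ^ 2 + n) / 2))
    ∧ HasSum
      (fun (k, l, r, s) =>
        (rho r s : ℂ)
          * ((delta (k - 1) : ℂ) - (delta r : ℂ)) * ((delta (l - 1) : ℂ) - (delta s : ℂ))
          * t ^ (k * (k + 1) / 2 + l * (l + 1) / 2 + 2 * r ^ 2 + 6 * r * s + 2 * s ^ 2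
              + 3 * r + 3 * s) :
        ℤ × ℤ × ℤ × ℤ → ℂ)
      (qPochInf (q ^ 2) (q ^ 2) * (∑' n : ℤ, q ^ (n * (n + 1) / 2)) ^ 2
          * ∑' n : ℤ, (-1 : ℂ) ^ n * q ^ (5 * n ^ 2 + n))
    ∧ HasSum
      (fun (k, l, r, s) =>
        (rho r s : ℂ)
          * ((delta (k - 1) : ℂ) - (delta (r + 1) : ℂ))
          * ((delta (l - 1) : ℂ) - (delta (s + 1) : ℂ))
          * t ^ (k * (k + 1) / 2 + l * (l + 1) / 2 + 2 * r ^ 2 + 6 * r * s + 2 * s ^ 2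
              + r + s - 2) :
        ℤ × ℤ × ℤ × ℤ → ℂ)
      (qPochInf (q ^ 2) (q ^ 2) * (∑' n : ℤ, q ^ (n * (n + 1) / 2)) ^ 2
          * ∑' n : ℤ, (-1 : ℂ) ^ n * q ^ (5 * n ^ 2 + 3 * n)) := by
  subst ht
  -- Adding exponents in integer powers needs `t ≠ 0`.
  rcases eq_or_ne t 0 with rfl | ht0
  · have h1 : ∑' n : ℤ, (-1 : ℂ) ^ n * (0 : ℂ) ^ (n ^ 2) = 1 :=
      tsum_zero_zpow (by norm_num) (by norm_num) fun n h => by simpa using h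
    have h2 : ∑' n : ℤ, (-1 : ℂ) ^ n * (0 : ℂ) ^ ((5 * n ^ 2 + 3 * n) / 2) = 1 :=
      tsum_zero_zpow (by norm_num) (by norm_num) fun n h => by
        rcases lt_trichotomy n 0 with h' | h' | h'
        -- The floor quotient by `2` also vanishes at numerator `1`, so the lower bound has to be
        -- `2`.
        · have : 2 ≤ 5 * n ^ 2 + 3 * n := by nlinarith
          omega
        · exact h'
        · have : 2 ≤ 5 * n ^ 2 + 3 * n := by nlinarith
          omega
    have h3 : ∑' n : ℤ, (-1 : ℂ) ^ n * (0 : ℂ) ^ ((5 * n ^ 2 + n) / 2) = 1 :=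
      tsum_zero_zpow (by norm_num) (by norm_num) fun n h => by
        rcases lt_trichotomy n 0 with h' | h' | h'
        · have : 2 ≤ 5 * n ^ 2 + n := by nlinarith
          omega
        · exact h'
        · have : 2 ≤ 5 * n ^ 2 + n := by nlinarith
          omega
    have h4 : ∑' n : ℤ, (-1 : ℂ) ^ n * (0 : ℂ) ^ (5 * n ^ 2 + n) = 1 :=
      tsum_zero_zpow (by norm_num) (by norm_num) fun n h => by
        rcases mul_eq_zero.1 (show n * (5 * n + 1) = 0 by linarith) with h' | h' <;> omega
    have h5 : ∑' n : ℤ, (-1 : ℂ) ^ n * (0 : ℂ) ^ (5 * n ^ 2 + 3 * n) = 1 :=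
      tsum_zero_zpow (by norm_num) (by norm_num) fun n h => by
        rcases mul_eq_zero.1 (show n * (5 * n + 3) = 0 by linarith) with h' | h' <;> omega
    rw [zero_pow three_ne_zero, zero_pow two_ne_zero, qPochInf_zero, h1, h2, h3, h4, h5,
      tsum_zero_zpow_triangular]
    simp only [one_mul, mul_one, one_pow]
    exact ⟨hasSum_hecke_one_zero.congr_fun fun _ => rfl,
      hasSum_hecke_two_zero.congr_fun fun _ => rfl,
      hasSum_hecke_three_zero.congr_fun fun _ => rfl, hasSum_hecke_four_zero.congr_fun fun _ => rfl⟩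
  · have ht1 : ‖t‖ < 1 := by
      rw [norm_pow] at hq
      exact lt_of_pow_lt_pow_left₀ 3 zero_le_one (by simpa using hq)
    exact ⟨(hasSum_hecke_one ht0 ht1).congr_fun fun _ => rfl,
      (hasSum_hecke_two ht0 ht1).congr_fun fun _ => rfl,
      (hasSum_hecke_three ht0 ht1).congr_fun fun _ => rfl,
      (hasSum_hecke_four ht0 ht1).congr_fun fun _ => rfl⟩
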